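/- Let $E$ be a finite alphabet with a distinguished letter denoted $0$. A \emph{triangular probabilistic cellular automaton} (TPCA) $A$ on $E$ is given by a transition matrix $T=(T(y,x,y';z))_{y,x,y',z\in E}$, with $T\ge 0$ and $\sum_z T(y,x,y';z)=1$. Given two lines $x,y\in E^{\mathbb Z}$, it produces a random line $z\in E^{\mathbb Z}$ whose letters are independent, $z_i$ having law $T(y_i,x_{i+1},y_{i+1};\cdot)$. A probability measure $\mu$ on $E^{\mathbb Z}\times E^{\mathbb Z}$ is \emph{invariant} by $A$ if, when $(x,y)\sim\mu$ and $z$ is produced from $(x,y)$ by $A$, also $(y,z)\sim\mu$. For stochastic matrices $D,U$ indexed by $E$, a probability measure $\mu$ on $E^{\mathbb Z}\times E^{\mathbb Z}$ is a \emph{$(D,U)$-HZMC distribution} if there are probability vectors $(\rho_k)_{k\in\mathbb Z}$ on $E$ with $\rho_{k+1}=\rho_k DU$ for all $k$ and, for all integers $k_1<k_2$ and all letters, $$\mu\big((x_i)_{k_1\le i\le k_2},(y_i)_{k_1\le i\le k_2-1}\big)=\rho_{k_1}(x_{k_1})\prod_{i=k_1}^{k_2-1}D(x_i;y_i)\,U(y_i;x_{i+1}).$$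 Let $A$ be a TPCA with positive rates, i.e. $T(y,x,y';z)>0$ for all $y,x,y',z\in E$. For $y,y'\in E$, let $\tilde T(y,y';\cdot)$ be the stochastic left eigenvector, for the eigenvalue $1$, of the stochastic matrix $(T(y,x,y';z))_{x,z\in E}$; let $\nu$ be the stochastic left eigenvector, for the eigenvalue $1$, of $(\tilde T(x,x;y))_{x,y\in E}$; let $\gamma$ be the stochastic left eigenvector of $\big(\nu(y)\,\tilde T(y,y;0)/\tilde T(y,x;0)\big)_{x,y\in E}$ for its maximal eigenvalue (real, and at least the modulus of every complex eigenvalue). These vectors exist and are unique, and $\tilde T>0$. Put $$D^\gamma(x;y)=\frac{\sum_{x'}\gamma(x')\,\tilde T(x,x';y)/\tilde T(x,x';0)}{\sum_{x''}\gamma(x'')/\tilde T(x,x'';0)},\qquad U^\gamma(y;x')=\frac{\gamma(x')\,\tilde T(0,x';y)/\tilde T(0,x';0)}{\sum_{x''}\gamma(x'')\,\tilde T(0,x'';y)/\tilde T(0,x'';0)}.$$ Then there is a stochastic matrix $D$ such that some $(D,D)$-HZMC distribution is invariant by $A$ if and only if the following conditions all hold: (1) $\tilde T(x,x';y)\,\tilde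 T(x,0;0)\,\tilde T(0,x';0)\,\tilde T(0,0;y)=\tilde T(0,0;0)\,\tilde T(x,x';0)\,\tilde T(0,x';y)\,\tilde T(x,0;y)$ for all $x,x',y\in E$; (2) $D^\gamma U^\gamma=U^\gamma D^\gamma$; (3) $D^\gamma=U^\gamma$. In this case, there is exactly one $(D^\gamma,D^\gamma)$-HZMC distribution, and it is invariant by $A$. -/

import Mathlib

open MeasureTheory ProbabilityTheory
open scoped Matrix

/-- A triangular probabilistic cellular automaton on the finite alphabet `E`, given by its transition
matrix: `T y x y' z` is the probability of writing `z` at site `i` of line `t + 2` when line `t`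
carries `x` at site `i + 1` and line `t + 1` carries `y`, `y'` at sites `i`, `i + 1`. -/
structure TPCA (E : Type*) [Fintype E] where
  T : E → E → E → E → ℝ
  nonneg : ∀ y x y' z, 0 ≤ T y x y' z
  sum_eq_one : ∀ y x y', ∑ z, T y x y' z = 1

namespace TPCA

variable {E : Type*} [Fintype E] [MeasurableSpace E] [DiscreteMeasurableSpace E]

/-- The probability measure `T(y, x, y'; ·)` on the alphabet. -/
noncomputable def localLaw (A : TPCA E) (y x y' : E) : Measure E :=
  ∑ z, ENNReal.ofReal (A.T y x y' z) • Measure.dirac z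

instance (A : TPCA E) (y x y' : E) : IsProbabilityMeasure (A.localLaw y x y') := by
  constructor
  simp only [localLaw, Measure.coe_finsetSum, Finset.sum_apply, Measure.smul_apply,
    measure_univ, smul_eq_mul, mul_one]
  rw [← ENNReal.ofReal_sum_of_nonneg (fun z _ => A.nonneg y x y' z), A.sum_eq_one,
    ENNReal.ofReal_one]

/-- The law of the new line `z` given the two previous lines `p = (x, y)`: the letters `z i` are
independent and `z i` has law `T(y i, x (i + 1), y (i + 1); ·)`. -/
noncomputable def lineLaw (A : TPCA E) (p : (ℤ → E) × (ℤ → E)) : Measure (ℤ → E) :=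
  Measure.infinitePi fun i : ℤ => A.localLaw (p.2 i) (p.1 (i + 1)) (p.2 (i + 1))

instance (A : TPCA E) (p : (ℤ → E) × (ℤ → E)) : IsProbabilityMeasure (A.lineLaw p) := by
  unfold lineLaw; infer_instance

theorem measurable_localLaw_apply (A : TPCA E) (i j : ℤ) (S : Set E) :
    Measurable fun p : (ℤ → E) × (ℤ → E) => A.localLaw (p.2 i) (p.1 j) (p.2 j) S := by
  have h1 : Measurable fun q : E × E × E => A.localLaw q.1 q.2.1 q.2.2 S := Measurable.of_discrete
  have h2 : Measurable fun p : (ℤ → E) × (ℤ → E) => (p.2 i, p.1 j, p.2 j) :=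
    measurable_snd.eval.prodMk (measurable_fst.eval.prodMk measurable_snd.eval)
  have h3 := h1.comp h2
  simp only [Function.comp_def] at h3
  exact h3

theorem measurable_lineLaw (A : TPCA E) : Measurable A.lineLaw := by
  refine Measurable.measure_of_isPiSystem_of_isProbabilityMeasure
    (generateFrom_squareCylinders (α := fun _ : ℤ => E)).symm
    (isPiSystem_squareCylinders (fun _ => MeasurableSpace.isPiSystem_measurableSet) (by simp)) ?_
  rintro s ⟨I, S, hS, rfl⟩
  have h : ∀ p, A.lineLaw p ((I : Set ℤ).pi S)
      = ∏ i ∈ I, A.localLaw (p.2 i) (p.1 (i + 1)) (p.2 (i + 1)) (S i) := fun p =>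
    Measure.infinitePi_pi _ (fun i _ => hS i (Set.mem_univ i))
  rw [funext h]
  exact Finset.measurable_fun_prod _ fun i _ => A.measurable_localLaw_apply i (i + 1) (S i)

/-- The transition kernel of the Markov chain of order two: two lines to the next line. -/
noncomputable def kernel (A : TPCA E) : Kernel ((ℤ → E) × (ℤ → E)) (ℤ → E) where
  toFun := A.lineLaw
  measurable' := A.measurable_lineLaw

instance (A : TPCA E) : IsMarkovKernel A.kernel :=
  ⟨fun p => inferInstanceAs (IsProbabilityMeasure (A.lineLaw p))⟩

/-- If `(S t, S (t + 1))` has law `μ`, then `(S (t + 1), S (t + 2))` has law `A.step μ`. -/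
noncomputable def step (A : TPCA E) (μ : Measure ((ℤ → E) × (ℤ → E))) :
    Measure ((ℤ → E) × (ℤ → E)) :=
  (μ ⊗ₘ A.kernel).map fun p => (p.1.2, p.2)

/-- `μ` is an invariant probability measure of `A`. -/
def IsInvariant (A : TPCA E) (μ : Measure ((ℤ → E) × (ℤ → E))) : Prop :=
  IsProbabilityMeasure μ ∧ A.step μ = μ

end TPCA

section HZMC

variable {E : Type*} [Fintype E] [DecidableEq E] [MeasurableSpace E]

/-- `μ` is a `(D, U)`-HZMC (horizontal zigzag Markov chain) distribution: along the zigzag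
`x k, y k, x (k + 1), y (k + 1), …` it is Markovian with alternating transition matrices `D`, `U`;
`ρ k` is the law of `x k`. -/
def IsHZMC (D U : Matrix E E ℝ) (μ : Measure ((ℤ → E) × (ℤ → E))) : Prop :=
  D ∈ Matrix.rowStochastic ℝ E ∧ U ∈ Matrix.rowStochastic ℝ E ∧ IsProbabilityMeasure μ ∧
  ∃ ρ : ℤ → E → ℝ,
    (∀ k, ρ k ∈ stdSimplex ℝ E) ∧
    (∀ k x', ρ (k + 1) x' = ∑ x, ρ k x * ∑ y, D x y * U y x') ∧
    ∀ k₁ k₂ : ℤ, k₁ < k₂ → ∀ x y : ℤ → E,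
      μ.real {p | (∀ i ∈ Set.Icc k₁ k₂, p.1 i = x i) ∧ ∀ i ∈ Set.Ico k₁ k₂, p.2 i = y i}
        = ρ k₁ (x k₁) * ∏ i ∈ Finset.Ico k₁ k₂, D (x i) (y i) * U (y i) (x (i + 1))

end HZMC

section Spectral

variable {E : Type*} [Fintype E]

/-- `v` is a stochastic left eigenvector of `P` for the eigenvalue `1`. -/
def IsStationaryVector (P : Matrix E E ℝ) (v : E → ℝ) : Prop :=
  v ∈ stdSimplex ℝ E ∧ v ᵥ* P = v

/-- The stochastic left eigenvector of `P` for the eigenvalue `1` (meaningful when it is unique). -/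
noncomputable def stationaryVector (P : Matrix E E ℝ) : E → ℝ :=
  Classical.epsilon (IsStationaryVector P)

/-- `v` is a stochastic left eigenvector of `M` for its maximal eigenvalue `l`: every complex
eigenvalue of `M` has modulus at most `l`. -/
def IsPerronVector (M : Matrix E E ℝ) (v : E → ℝ) : Prop :=
  v ∈ stdSimplex ℝ E ∧ ∃ l : ℝ, v ᵥ* M = l • v ∧
    ∀ (z : ℂ) (w : E → ℂ), w ≠ 0 → w ᵥ* (M.map fun r : ℝ => (r : ℂ)) = z • w → ‖z‖ ≤ l

/-- The stochastic left eigenvector of `M` for its maximal eigenvalue (meaningful when it is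
unique). -/
noncomputable def perronVector (M : Matrix E E ℝ) : E → ℝ :=
  Classical.epsilon (IsPerronVector M)

end Spectral

/-! Transition matrices `K` from `E × E` to `E` (of square PCA); `K x x' y` is the probability of
`y` given `x, x'`, and the letter `o` plays the role of the letter `0` of the alphabet. -/

namespace SPCA

variable {E : Type*} [Fintype E]

/-- The matrix `(K(x, x; y))`. -/
def diagMatrix (K : E → E → E → ℝ) : Matrix E E ℝ :=
  Matrix.of fun x y => K x x y

noncomputable def nu (K : E → E → E → ℝ) : E → ℝ :=
  stationaryVector (diagMatrix K)

/-- The matrix `(ν(y) K(y, y; 0) / K(y, x; 0))`. -/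
noncomputable def gammaMatrix (o : E) (K : E → E → E → ℝ) : Matrix E E ℝ :=
  Matrix.of fun x y => nu K y * (K y y o / K y x o)

noncomputable def gamma (o : E) (K : E → E → E → ℝ) : E → ℝ :=
  perronVector (gammaMatrix o K)

/-- The transition matrix `D^η`. -/
noncomputable def Dmat (o : E) (K : E → E → E → ℝ) (η : E → ℝ) : Matrix E E ℝ :=
  Matrix.of fun x y => (∑ x', η x' * (K x x' y / K x x' o)) / ∑ x', η x' / K x x' o

/-- The transition matrix `U^η`. -/
noncomputable def Umat (o : E) (K : E → E → E → ℝ) (η : E → ℝ) : Matrix E E ℝ :=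
  Matrix.of fun y x' =>
    (η x' * (K o x' y / K o x' o)) / ∑ x'', η x'' * (K o x'' y / K o x'' o)

def Cond1 (o : E) (K : E → E → E → ℝ) : Prop :=
  ∀ x x' y, K x x' y * K x o o * K o x' o * K o o y = K o o o * K x x' o * K o x' y * K x o y

def Cond2 (o : E) (K : E → E → E → ℝ) : Prop :=
  Dmat o K (gamma o K) * Umat o K (gamma o K) = Umat o K (gamma o K) * Dmat o K (gamma o K)

end SPCA

namespace TPCA

variable {E : Type*} [Fintype E]

/-- The stochastic matrix `(T(y, x, y'; z) : x, z)` for fixed `y, y'`. -/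
def sliceMatrix (A : TPCA E) (y y' : E) : Matrix E E ℝ :=
  Matrix.of fun x z => A.T y x y' z

/-- The kernel `T̃`: `T̃(y, y'; ·)` is the stationary vector of `x ↦ T(y, x, y'; ·)`. -/
noncomputable def tilde (A : TPCA E) (y y' : E) : E → ℝ :=
  stationaryVector (A.sliceMatrix y y')

end TPCA

/-! Write `K` for `A.tilde`. Under a `(D, D)`-HZMC distribution the zigzag is a single chain with
matrix `D`, so given the second line `y` the letters of the first line strictly between its sites
are independent midpoints of `D`-bridges. Hence one step of `A` writes `z` between `y` and `y'` with
weight `bridgeRate D y y' z`, and invariance amounts to `bridgeRate D y y' z = D y z * D z y'`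
together with stationarity of the one-site law. The first identity says that the bridge law from `y`
to `y'` is stationary for `sliceMatrix y y'`. By Perron-Frobenius uniqueness this means that it is
`K y y'`, which is `IsBridgeKernel D K`: the dynamics of `A` enters only through `K`.

The rest is algebra. If `K` is the bridge kernel of `D`, then (1) is a cancellation, `ν` is the
normalized diagonal of `D * D`, `γ` is the row `D o`, and both `Dmat` and `Umat` give back `D`.
Conversely, (1) makes `Dmat x y * Umat y x'` proportional to `K x x' y` as a function of `y`, so (3)
gives the bridge identity; (2) follows from (3). A `(D, D)`-HZMC distribution with `D` positive is
the stationary `D`-chain read at even and odd sites. It is unique because a two-sided orbit of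
probability vectors under a positive stochastic matrix is constant. -/

/-! ### Perron-Frobenius theory for positive matrices. -/

section Perron

variable {E : Type*} [Fintype E]

theorem pos_of_mem_stdSimplex_of_vecMul_eq_smul {M : Matrix E E ℝ} (hM : ∀ i j, 0 < M i j)
    {v : E → ℝ} (hv : v ∈ stdSimplex ℝ E) {l : ℝ} (h : v ᵥ* M = l • v) (j : E) : 0 < v j := by
  obtain ⟨i, hi⟩ : ∃ i, v i ≠ 0 := by
    by_contra! h0
    have := hv.2
    simp [h0] at this
  have h1 : 0 < (v ᵥ* M) j :=
    Finset.sum_pos' (fun k _ => mul_nonneg (hv.1 k) (hM k j).le)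
      ⟨i, Finset.mem_univ i, mul_pos (lt_of_le_of_ne (hv.1 i) (Ne.symm hi)) (hM i j)⟩
  rw [h] at h1
  refine lt_of_le_of_ne (hv.1 j) fun h0 => ?_
  simp [← h0] at h1

/-- Collatz-Wielandt argument: maximize `l` over the pairs with `l • x ≤ x ᵥ* M`. If the inequality
were not an equality, applying `M` once more would make it strict at every coordinate, leaving room
for a larger `l`. -/
theorem exists_pos_eigenvector [Nonempty E] {M : Matrix E E ℝ} (hM : ∀ i j, 0 < M i j) :
    ∃ (l : ℝ) (v : E → ℝ), v ∈ stdSimplex ℝ E ∧ (∀ i, 0 < v i) ∧ v ᵥ* M = l • v := by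
  classical
  set C : ℝ := ∑ i, ∑ j, M i j
  let S : Set (ℝ × (E → ℝ)) :=
    (Set.Icc 0 C ×ˢ stdSimplex ℝ E) ∩ {p | ∀ j, p.1 * p.2 j ≤ (p.2 ᵥ* M) j}
  have hbound : ∀ (l : ℝ) (x : E → ℝ), x ∈ stdSimplex ℝ E →
      (∀ j, l * x j ≤ (x ᵥ* M) j) → l ≤ C := by
    intro l x hx h
    have hx1 : ∀ i, x i ≤ 1 := fun i => hx.2 ▸
      Finset.single_le_sum (f := x) (fun k _ => hx.1 k) (Finset.mem_univ i)
    calc l = ∑ j, l * x j := by rw [← Finset.mul_sum, hx.2, mul_one]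
      _ ≤ ∑ j, ∑ i, x i * M i j := Finset.sum_le_sum fun j _ => h j
      _ ≤ ∑ j, ∑ i, M i j := Finset.sum_le_sum fun j _ => Finset.sum_le_sum fun i _ =>
          mul_le_of_le_one_left (hM i j).le (hx1 i)
      _ = C := Finset.sum_comm
  have hS : IsCompact S := by
    refine (isCompact_Icc.prod (isCompact_stdSimplex ℝ E)).inter_right ?_
    simp only [Set.ofPred_forall]
    refine isClosed_iInter fun j => isClosed_le (by fun_prop) ?_
    simp only [Matrix.vecMul, dotProduct]
    fun_prop
  have hSne : S.Nonempty := by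
    obtain ⟨i₀⟩ := ‹Nonempty E›
    refine ⟨(0, Pi.single i₀ 1), ⟨⟨le_rfl, ?_⟩, single_mem_stdSimplex ℝ i₀⟩, fun j => ?_⟩
    · exact Finset.sum_nonneg fun i _ => Finset.sum_nonneg fun j _ => (hM i j).le
    · simpa using (hM i₀ j).le
  obtain ⟨⟨l, x⟩, ⟨⟨hl, hx⟩, hlx⟩, hmax⟩ := hS.exists_isMaxOn hSne continuous_fst.continuousOn
  simp only at hl hx hlx
  have heq : x ᵥ* M = l • x := by
    by_contra hne
    set y : E → ℝ := x ᵥ* M - l • x with hy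
    have hy0 : ∀ j, 0 ≤ y j := fun j => by simpa [hy] using hlx j
    obtain ⟨i, hi⟩ : ∃ i, y i ≠ 0 := by
      by_contra! h0
      exact hne (sub_eq_zero.1 (funext h0))
    have hyM : ∀ j, 0 < (y ᵥ* M) j := fun j =>
      Finset.sum_pos' (fun k _ => mul_nonneg (hy0 k) (hM k j).le)
        ⟨i, Finset.mem_univ i, mul_pos (lt_of_le_of_ne (hy0 i) (Ne.symm hi)) (hM i j)⟩
    set u : E → ℝ := x ᵥ* M with hu
    obtain ⟨k, hk⟩ : ∃ i, x i ≠ 0 := by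
      by_contra! h0
      have := hx.2
      simp [h0] at this
    have hu0 : ∀ j, 0 < u j := fun j =>
      Finset.sum_pos' (fun k _ => mul_nonneg (hx.1 k) (hM k j).le)
        ⟨k, Finset.mem_univ k, mul_pos (lt_of_le_of_ne (hx.1 k) (Ne.symm hk)) (hM k j)⟩
    -- Since `y ᵥ* M = u ᵥ* M - l • u`, the smallest ratio to `u` is the amount by which `l` can be
    -- raised.
    obtain ⟨j₀, hj₀⟩ := Finite.exists_min fun j => (y ᵥ* M) j / u j
    set ε := (y ᵥ* M) j₀ / u j₀
    have hε : 0 < ε := div_pos (hyM j₀) (hu0 j₀)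
    have hεu : ∀ j, (l + ε) * u j ≤ (u ᵥ* M) j := by
      intro j
      have h1 : ε * u j ≤ (y ᵥ* M) j := (le_div_iff₀ (hu0 j)).1 (hj₀ j)
      have h2 : (y ᵥ* M) j = (u ᵥ* M) j - l * u j := by
        simp only [hy, Matrix.sub_vecMul, Matrix.smul_vecMul, ← hu, Pi.sub_apply, Pi.smul_apply,
          smul_eq_mul]
      linarith
    have hs : 0 < ∑ j, u j := Finset.sum_pos (fun j _ => hu0 j) Finset.univ_nonempty
    set w : E → ℝ := (∑ j, u j)⁻¹ • u with hw
    have hwS : w ∈ stdSimplex ℝ E := by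
      refine ⟨fun j => mul_nonneg (inv_nonneg.2 hs.le) (hu0 j).le, ?_⟩
      simp only [hw, Pi.smul_apply, smul_eq_mul, ← Finset.mul_sum]
      exact inv_mul_cancel₀ hs.ne'
    have hwM : ∀ j, (l + ε) * w j ≤ (w ᵥ* M) j := by
      intro j
      simp only [hw, Matrix.smul_vecMul, Pi.smul_apply, smul_eq_mul]
      rw [mul_left_comm]
      exact mul_le_mul_of_nonneg_left (hεu j) (inv_nonneg.2 hs.le)
    have := hmax (a := (l + ε, w)) ⟨⟨⟨by linarith [hl.1], hbound _ _ hwS hwM⟩, hwS⟩, hwM⟩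
    simp only [Set.mem_ofPred_eq] at this
    linarith
  exact ⟨l, x, hx, pos_of_mem_stdSimplex_of_vecMul_eq_smul hM hx heq, heq⟩

/-- Touching argument: with `t` the least ratio, `v - t • w` is nonnegative and vanishes at `i`, and
coordinate `i` of its image under `M` is `t * w i * (l - m)`. If `l = m`, a sum of nonnegative terms
with positive weights is zero, so `v = t • w`. -/
theorem exists_ratio_of_pos_eigenvectors [Nonempty E] {M : Matrix E E ℝ} (hM : ∀ i j, 0 < M i j)
    {v w : E → ℝ} (hw : ∀ i, 0 < w i) {l m : ℝ} (hvl : v ᵥ* M = l • v) (hwm : w ᵥ* M = m • w) :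
    ∃ (i : E) (t : ℝ), v i = t * w i ∧ (∀ j, t * w j ≤ v j) ∧ 0 ≤ t * w i * (l - m) ∧
      (l = m → ∀ j, v j = t * w j) := by
  obtain ⟨i, hi⟩ := Finite.exists_min fun j => v j / w j
  have hit : v i = v i / w i * w i := (div_mul_cancel₀ _ (hw i).ne').symm
  have hle : ∀ j, v i / w i * w j ≤ v j := fun j => (le_div_iff₀ (hw j)).1 (hi j)
  set t := v i / w i
  have hsum : ∑ j, (v j - t * w j) * M j i = t * w i * (l - m) := by
    have h1 : ∑ j, v j * M j i = l * v i := congrFun hvl i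
    have h2 : ∑ j, w j * M j i = m * w i := congrFun hwm i
    simp only [sub_mul, Finset.sum_sub_distrib, mul_assoc, ← Finset.mul_sum]
    rw [h1, h2, hit]
    ring
  have hnn : ∀ j ∈ Finset.univ, 0 ≤ (v j - t * w j) * M j i := fun j _ =>
    mul_nonneg (sub_nonneg.2 (hle j)) (hM j i).le
  refine ⟨i, t, hit, hle, hsum ▸ Finset.sum_nonneg hnn, fun hlm j => ?_⟩
  rw [hlm, sub_self, mul_zero, Finset.sum_eq_zero_iff_of_nonneg hnn] at hsum
  have := hsum j (Finset.mem_univ j)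
  rcases mul_eq_zero.1 this with h | h
  · linarith
  · exact absurd h (hM j i).ne'

theorem eigenvalue_le_of_pos [Nonempty E] {M : Matrix E E ℝ} (hM : ∀ i j, 0 < M i j)
    {v w : E → ℝ} (hv : ∀ i, 0 < v i) (hw : ∀ i, 0 < w i) {l m : ℝ} (hvl : v ᵥ* M = l • v)
    (hwm : w ᵥ* M = m • w) : m ≤ l := by
  obtain ⟨i, t, hit, -, h, -⟩ := exists_ratio_of_pos_eigenvectors hM hw hvl hwm
  rw [← hit] at h
  exact sub_nonneg.1 (nonneg_of_mul_nonneg_right h (hv i))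

theorem eigenvector_unique [Nonempty E] {M : Matrix E E ℝ} (hM : ∀ i j, 0 < M i j)
    {v w : E → ℝ} (hv : v ∈ stdSimplex ℝ E) (hw : w ∈ stdSimplex ℝ E) {l m : ℝ}
    (hvl : v ᵥ* M = l • v) (hwm : w ᵥ* M = m • w) : v = w := by
  have hv0 := pos_of_mem_stdSimplex_of_vecMul_eq_smul hM hv hvl
  have hw0 := pos_of_mem_stdSimplex_of_vecMul_eq_smul hM hw hwm
  obtain ⟨i, t, -, -, -, h⟩ := exists_ratio_of_pos_eigenvectors hM hw0 hvl hwm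
  have h' := h (le_antisymm (eigenvalue_le_of_pos hM hw0 hv0 hwm hvl)
    (eigenvalue_le_of_pos hM hv0 hw0 hvl hwm))
  have ht : t = 1 := by
    have := hv.2
    simp only [h', ← Finset.mul_sum, hw.2, mul_one] at this
    exact this
  ext j
  rw [h' j, ht, one_mul]

/-- Compare `‖w‖` with `v` at the coordinate where their ratio is largest and apply the triangle
inequality there. -/
theorem norm_eigenvalue_le [Nonempty E] {M : Matrix E E ℝ} (hM : ∀ i j, 0 < M i j)
    {v : E → ℝ} (hv : ∀ i, 0 < v i) {l : ℝ} (hvl : v ᵥ* M = l • v) {z : ℂ} {w : E → ℂ}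
    (hw : w ≠ 0) (h : w ᵥ* (M.map fun r : ℝ => (r : ℂ)) = z • w) : ‖z‖ ≤ l := by
  obtain ⟨i, hi⟩ := Finite.exists_max fun j => ‖w j‖ / v j
  set t := ‖w i‖ / v i with ht
  have hle : ∀ j, ‖w j‖ ≤ t * v j := fun j => (div_le_iff₀ (hv j)).1 (hi j)
  have hit : ‖w i‖ = t * v i := (div_mul_cancel₀ _ (hv i).ne').symm
  obtain ⟨k, hk⟩ := Function.ne_iff.1 hw
  have hwi : 0 < ‖w i‖ := by
    have h1 : 0 < t * v k := (norm_pos_iff.2 hk).trans_le (hle k)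
    rw [hit]
    exact mul_pos (pos_of_mul_pos_left h1 (hv k).le) (hv i)
  have h1 : ∑ j, v j * M j i = l * v i := congrFun hvl i
  have h2 : ∑ j, w j * (M j i : ℂ) = z * w i := congrFun h i
  have h3 : ‖z‖ * ‖w i‖ ≤ l * ‖w i‖ := by
    rw [← norm_mul, ← h2]
    calc ‖∑ j, w j * (M j i : ℂ)‖ ≤ ∑ j, ‖w j * (M j i : ℂ)‖ := norm_sum_le _ _
      _ ≤ ∑ j, t * (v j * M j i) := Finset.sum_le_sum fun j _ => by
          rw [norm_mul, Complex.norm_real, Real.norm_of_nonneg (hM j i).le, ← mul_assoc]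
          exact mul_le_mul_of_nonneg_right (hle j) (hM j i).le
      _ = l * ‖w i‖ := by rw [← Finset.mul_sum, h1, hit]; ring
  exact le_of_mul_le_mul_right h3 hwi

theorem existsUnique_isPerronVector [Nonempty E] {M : Matrix E E ℝ} (hM : ∀ i j, 0 < M i j) :
    ∃! v : E → ℝ, IsPerronVector M v := by
  obtain ⟨l, v, hv, hv0, h⟩ := exists_pos_eigenvector hM
  refine ⟨v, ⟨hv, l, h, fun z w hw hz => norm_eigenvalue_le hM hv0 h hw hz⟩, ?_⟩
  rintro w ⟨hw, m, hm, -⟩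
  exact eigenvector_unique hM hw hv hm h

/-- Makes any stochastic eigenvector, once exhibited, the Perron vector; this is how `γ` gets
computed. -/
theorem isPerronVector_of_vecMul_eq_smul [Nonempty E] {M : Matrix E E ℝ} (hM : ∀ i j, 0 < M i j)
    {v : E → ℝ} (hv : v ∈ stdSimplex ℝ E) {l : ℝ} (h : v ᵥ* M = l • v) : IsPerronVector M v :=
  ⟨hv, l, h, fun _ _ hw hz =>
    norm_eigenvalue_le hM (pos_of_mem_stdSimplex_of_vecMul_eq_smul hM hv h) h hw hz⟩

theorem existsUnique_isStationaryVector [Nonempty E] {P : Matrix E E ℝ} (hP : ∀ i j, 0 < P i j)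
    (h1 : ∀ i, ∑ j, P i j = 1) : ∃! v : E → ℝ, IsStationaryVector P v := by
  obtain ⟨l, v, hv, -, h⟩ := exists_pos_eigenvector hP
  -- Summing the coordinates of the eigenvector equation preserves total mass.
  have hl : l = 1 := by
    have h2 : ∑ j, ∑ i, v i * P i j = ∑ j, l * v j :=
      Finset.sum_congr rfl fun j _ => congrFun h j
    rw [Finset.sum_comm] at h2
    simp only [← Finset.mul_sum, h1, mul_one, hv.2] at h2
    exact h2.symm
  rw [hl, one_smul] at h
  refine ⟨v, ⟨hv, h⟩, fun w hw => ?_⟩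
  exact eigenvector_unique hP hw.1 hv (l := 1) (m := 1) (by rw [hw.2, one_smul])
    (by rw [h, one_smul])

theorem IsStationaryVector.pos {P : Matrix E E ℝ} {v : E → ℝ} (hv : IsStationaryVector P v)
    (hP : ∀ i j, 0 < P i j) (i : E) : 0 < v i :=
  pos_of_mem_stdSimplex_of_vecMul_eq_smul hP hv.1 (l := 1) (by rw [hv.2, one_smul]) i

theorem isStationaryVector_stationaryVector {P : Matrix E E ℝ}
    (h : ∃! v : E → ℝ, IsStationaryVector P v) : IsStationaryVector P (stationaryVector P) :=
  Classical.epsilon_spec h.exists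

theorem isPerronVector_perronVector {M : Matrix E E ℝ}
    (h : ∃! v : E → ℝ, IsPerronVector M v) : IsPerronVector M (perronVector M) :=
  Classical.epsilon_spec h.exists

end Perron

/-! ### Algebra of bridge kernels: `ν`, `γ`, `Dmat` and `Umat`. -/

namespace SPCA

variable {E : Type*} [Fintype E]

section Positive

variable [Nonempty E] {o : E} {K : E → E → E → ℝ}

theorem existsUnique_nu (hK : ∀ x x' y, 0 < K x x' y) (hK1 : ∀ x x', ∑ y, K x x' y = 1) :
    ∃! v : E → ℝ, IsStationaryVector (diagMatrix K) v :=
  existsUnique_isStationaryVector (fun x y => hK x x y) fun x => hK1 x x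

theorem isStationaryVector_nu (hK : ∀ x x' y, 0 < K x x' y) (hK1 : ∀ x x', ∑ y, K x x' y = 1) :
    IsStationaryVector (diagMatrix K) (nu K) :=
  isStationaryVector_stationaryVector (existsUnique_nu hK hK1)

theorem gammaMatrix_pos (hK : ∀ x x' y, 0 < K x x' y) (hK1 : ∀ x x', ∑ y, K x x' y = 1)
    (x y : E) : 0 < gammaMatrix o K x y :=
  mul_pos ((isStationaryVector_nu hK hK1).pos (fun x y => hK x x y) y)
    (div_pos (hK y y o) (hK y x o))

theorem existsUnique_gamma (hK : ∀ x x' y, 0 < K x x' y) (hK1 : ∀ x x', ∑ y, K x x' y = 1) :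
    ∃! v : E → ℝ, IsPerronVector (gammaMatrix o K) v :=
  existsUnique_isPerronVector (gammaMatrix_pos hK hK1)

theorem isPerronVector_gamma (hK : ∀ x x' y, 0 < K x x' y) (hK1 : ∀ x x', ∑ y, K x x' y = 1) :
    IsPerronVector (gammaMatrix o K) (gamma o K) :=
  isPerronVector_perronVector (existsUnique_gamma hK hK1)

theorem gamma_pos (hK : ∀ x x' y, 0 < K x x' y) (hK1 : ∀ x x', ∑ y, K x x' y = 1) (x : E) :
    0 < gamma o K x := by
  obtain ⟨h, l, hl, -⟩ := isPerronVector_gamma (o := o) hK hK1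
  exact pos_of_mem_stdSimplex_of_vecMul_eq_smul (gammaMatrix_pos hK hK1) h hl x

end Positive

/-- `K` is the law of the midpoint of a two-step bridge of the chain with transition matrix `D`. -/
def IsBridgeKernel (D : Matrix E E ℝ) (K : E → E → E → ℝ) : Prop :=
  ∀ x x' y, D x y * D y x' = (D * D) x x' * K x x' y

section Bridge

variable {o : E} {K : E → E → E → ℝ} {D : Matrix E E ℝ}

theorem mul_self_pos [Nonempty E] (hD : ∀ x y, 0 < D x y) (x y : E) : 0 < (D * D) x y :=
  Finset.sum_pos (fun z _ => mul_pos (hD x z) (hD z y)) Finset.univ_nonempty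

theorem IsBridgeKernel.eq_div [Nonempty E] (h : IsBridgeKernel D K) (hD : ∀ x y, 0 < D x y)
    (x x' y : E) : K x x' y = D x y * D y x' / (D * D) x x' := by
  rw [h x x' y, mul_div_cancel_left₀ _ (mul_self_pos hD x x').ne']

/-- Each entry of `D` and of `D * D` occurs equally often on the two sides. -/
theorem IsBridgeKernel.cond1 [Nonempty E] (h : IsBridgeKernel D K) (hD : ∀ x y, 0 < D x y) :
    Cond1 o K := by
  intro x x' y
  simp only [h.eq_div hD]
  have h0 := fun x y => (mul_self_pos hD x y).ne'
  field_simp [h0]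

/-- Detailed balance: `(D * D) x x * K x x y = D x y * D y x` is symmetric in `x` and `y`. -/
theorem IsBridgeKernel.nu_eq [Nonempty E] (h : IsBridgeKernel D K) (hD : ∀ x y, 0 < D x y)
    (hK : ∀ x x' y, 0 < K x x' y) (hK1 : ∀ x x', ∑ y, K x x' y = 1) (x : E) :
    nu K x = (D * D) x x / ∑ y, (D * D) y y := by
  have hs : 0 < ∑ y, (D * D) y y :=
    Finset.sum_pos (fun y _ => mul_self_pos hD y y) Finset.univ_nonempty
  have hv : IsStationaryVector (diagMatrix K) fun x => (D * D) x x / ∑ y, (D * D) y y := by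
    refine ⟨⟨fun x => div_nonneg (mul_self_pos hD x x).le hs.le, ?_⟩, ?_⟩
    · rw [← Finset.sum_div, div_self hs.ne']
    · ext y
      change ∑ x, (D * D) x x / _ * K x x y = _
      simp only [div_mul_eq_mul_div, ← h _ _ _, ← Finset.sum_div]
      rw [Matrix.mul_apply]
      simp only [mul_comm]
  exact congrFun ((existsUnique_nu hK hK1).unique (isStationaryVector_nu hK hK1) hv) x

/-- Conjugation by the diagonal of `D o` turns `gammaMatrix` into the transpose of `D * D` divided
by its trace, and the rows of `D * D` sum to `1`. The eigenvalue is the inverse trace. -/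
theorem IsBridgeKernel.gamma_eq [Nonempty E] (h : IsBridgeKernel D K) (hD : ∀ x y, 0 < D x y)
    (hD1 : ∀ x, ∑ y, D x y = 1)
    (hK : ∀ x x' y, 0 < K x x' y) (hK1 : ∀ x x', ∑ y, K x x' y = 1) :
    gamma o K = D o := by
  have hs : 0 < ∑ y, (D * D) y y :=
    Finset.sum_pos (fun y _ => mul_self_pos hD y y) Finset.univ_nonempty
  have h0 := fun x y => (mul_self_pos hD x y).ne'
  have hM : ∀ x y, D o x * gammaMatrix o K x y
      = D o y * ((D * D) y x / ∑ z, (D * D) z z) := by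
    intro x y
    have hx := (hD o x).ne'
    have hy := (hD y o).ne'
    simp only [gammaMatrix, Matrix.of_apply, h.nu_eq hD hK hK1, h.eq_div hD]
    field_simp [h0]
  have hD2 : ∀ y, ∑ x, (D * D) y x = 1 := by
    intro y
    simp only [Matrix.mul_apply]
    rw [Finset.sum_comm]
    simp only [← Finset.mul_sum, hD1, mul_one]
  refine (existsUnique_gamma hK hK1).unique (isPerronVector_gamma hK hK1)
    (isPerronVector_of_vecMul_eq_smul (gammaMatrix_pos hK hK1) ⟨fun x => (hD o x).le, hD1 o⟩
      (l := (∑ z, (D * D) z z)⁻¹) ?_)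
  ext y
  change ∑ x, D o x * gammaMatrix o K x y = _ * D o y
  simp only [hM, ← Finset.mul_sum, ← Finset.sum_div, hD2]
  ring

theorem IsBridgeKernel.Dmat_eq [Nonempty E] (h : IsBridgeKernel D K) (hD : ∀ x y, 0 < D x y)
    (hD1 : ∀ x, ∑ y, D x y = 1) : Dmat o K (D o) = D := by
  have h0 := fun x y => (mul_self_pos hD x y).ne'
  ext x y
  have hx := (hD x o).ne'
  have h1 : ∀ x', D o x' * (K x x' y / K x x' o) = D x y / D x o * D y x' := by
    intro x'
    have := (hD o x').ne'
    simp only [h.eq_div hD]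
    field_simp [h0]
  have h2 : ∀ x', D o x' / K x x' o = (D * D) x x' / D x o := by
    intro x'
    have := (hD o x').ne'
    simp only [h.eq_div hD]
    field_simp [h0]
  have hD2 : ∑ x', (D * D) x x' = 1 := by
    simp only [Matrix.mul_apply]
    rw [Finset.sum_comm]
    simp only [← Finset.mul_sum, hD1, mul_one]
  simp only [Dmat, Matrix.of_apply, h1, h2, ← Finset.mul_sum, ← Finset.sum_div, hD1, hD2]
  field_simp

theorem IsBridgeKernel.Umat_eq [Nonempty E] (h : IsBridgeKernel D K) (hD : ∀ x y, 0 < D x y)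
    (hD1 : ∀ x, ∑ y, D x y = 1) : Umat o K (D o) = D := by
  have h0 := fun x y => (mul_self_pos hD x y).ne'
  ext y x'
  have hy := (hD o y).ne'
  have ho := (hD o o).ne'
  have h1 : ∀ x', D o x' * (K o x' y / K o x' o) = D o y / D o o * D y x' := by
    intro x'
    have := (hD o x').ne'
    simp only [h.eq_div hD]
    field_simp [h0]
  simp only [Umat, Matrix.of_apply, h1, ← Finset.mul_sum, hD1]
  field_simp

theorem Umat_pos [Nonempty E] (hK : ∀ x x' y, 0 < K x x' y) {η : E → ℝ} (hη : ∀ x, 0 < η x)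
    (x y : E) : 0 < Umat o K η x y :=
  div_pos (mul_pos (hη y) (div_pos (hK _ _ _) (hK _ _ _))) <|
    Finset.sum_pos (fun z _ => mul_pos (hη z) (div_pos (hK _ _ _) (hK _ _ _)))
      Finset.univ_nonempty

theorem sum_Umat [Nonempty E] (hK : ∀ x x' y, 0 < K x x' y) {η : E → ℝ} (hη : ∀ x, 0 < η x)
    (x : E) : ∑ y, Umat o K η x y = 1 := by
  simp only [Umat, Matrix.of_apply, ← Finset.sum_div]
  exact div_self (Finset.sum_pos (fun z _ => mul_pos (hη z) (div_pos (hK _ _ _) (hK _ _ _)))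
    Finset.univ_nonempty).ne'

/-- By (1), changing `x` to `o` multiplies `K x x' y / K x x' o` by a factor independent of `x'`. So
the numerator of `Dmat` is a multiple of the denominator of `Umat`, and after cancellation the
coefficient of `K x x' y` is free of `y`. -/
theorem Dmat_mul_Umat_apply [Nonempty E] (hK : ∀ x x' y, 0 < K x x' y) (h1 : Cond1 o K)
    {η : E → ℝ} (hη : ∀ x, 0 < η x) (x x' y : E) :
    Dmat o K η x y * Umat o K η y x'
      = η x' / (K x x' o * ∑ x'', η x'' / K x x'' o) * K x x' y := by
  have hK0 := fun x x' y => (hK x x' y).ne'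
  have hratio : ∀ x', η x' * (K x x' y / K x x' o)
      = K o o o * K x o y / (K x o o * K o o y) * (η x' * (K o x' y / K o x' o)) := by
    intro x'
    have := h1 x x' y
    field_simp [hK0]
    linear_combination η x' * this
  have hg : 0 < ∑ x'', η x'' * (K o x'' y / K o x'' o) :=
    Finset.sum_pos (fun z _ => mul_pos (hη z) (div_pos (hK _ _ _) (hK _ _ _)))
      Finset.univ_nonempty
  have hc : 0 < ∑ x'', η x'' / K x x'' o :=
    Finset.sum_pos (fun z _ => div_pos (hη z) (hK _ _ _)) Finset.univ_nonempty
  simp only [Dmat, Umat, Matrix.of_apply]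
  rw [Finset.sum_congr rfl fun x' _ => hratio x', ← Finset.mul_sum]
  have h2 := hratio x'
  set g := ∑ x'', η x'' * (K o x'' y / K o x'' o)
  set c := ∑ x'', η x'' / K x x'' o
  rw [show η x' / (K x x' o * c) * K x x' y = η x' * (K x x' y / K x x' o) / c by
    field_simp [hK0], h2]
  field_simp

/-- Summing the product formula over `y` identifies its coefficient as the entry of `D * D`. -/
theorem isBridgeKernel_of_cond1 [Nonempty E] (hK : ∀ x x' y, 0 < K x x' y)
    (hK1 : ∀ x x', ∑ y, K x x' y = 1) (h1 : Cond1 o K) {η : E → ℝ} (hη : ∀ x, 0 < η x)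
    (h : Dmat o K η = Umat o K η) : IsBridgeKernel (Dmat o K η) K := by
  intro x x' y
  have hmul := Dmat_mul_Umat_apply hK h1 hη x x'
  rw [← h] at hmul
  rw [Matrix.mul_apply]
  simp only [hmul, ← Finset.mul_sum, hK1, mul_one]

end Bridge

end SPCA

/-! ### Products over integer intervals. -/

section IntegerIntervals

theorem prod_Ico_add_one_right_eq_mul {k₁ k₂ : ℤ} (h : k₁ ≤ k₂) (G : ℤ → ℝ) :
    ∏ i ∈ Finset.Ico k₁ (k₂ + 1), G i = (∏ i ∈ Finset.Ico k₁ k₂, G i) * G k₂ := by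
  have : Finset.Ico k₁ (k₂ + 1) = insert k₂ (Finset.Ico k₁ k₂) := by
    ext i; simp only [Finset.mem_Ico, Finset.mem_insert]; omega
  rw [this, Finset.prod_insert (by simp), mul_comm]

theorem prod_Ico_add_one_right_eq_mul_shift {k₁ k₂ : ℤ} (h : k₁ ≤ k₂) (G : ℤ → ℝ) :
    ∏ i ∈ Finset.Ico k₁ (k₂ + 1), G i = G k₁ * ∏ i ∈ Finset.Ico k₁ k₂, G (i + 1) := by
  have : Finset.Ico k₁ (k₂ + 1)
      = insert k₁ ((Finset.Ico k₁ k₂).map (addRightEmbedding 1)) := by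
    ext i
    simp only [Finset.mem_Ico, Finset.mem_insert, Finset.mem_map, addRightEmbedding_apply]
    constructor
    · intro hi
      rcases eq_or_ne i k₁ with h1 | h1
      · exact Or.inl h1
      · exact Or.inr ⟨i - 1, by omega, by omega⟩
    · rintro (rfl | ⟨j, hj, rfl⟩) <;> omega
  rw [this, Finset.prod_insert, Finset.prod_map]
  · rfl
  · simp only [Finset.mem_map, Finset.mem_Ico, addRightEmbedding_apply, not_exists]
    omega

theorem prod_Icc_add_one_eq_mul {k₁ k₂ : ℤ} (h : k₁ ≤ k₂) (G : ℤ → ℝ) :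
    ∏ i ∈ Finset.Icc k₁ (k₂ + 1), G i
      = G k₁ * (∏ i ∈ Finset.Ico k₁ k₂, G (i + 1)) * G (k₂ + 1) := by
  have : Finset.Icc k₁ (k₂ + 1) = Finset.Ico k₁ (k₂ + 1 + 1) := by
    ext i; simp only [Finset.mem_Ico, Finset.mem_Icc]; omega
  rw [this, prod_Ico_add_one_right_eq_mul_shift (by omega), prod_Ico_add_one_right_eq_mul h,
    mul_assoc]

end IntegerIntervals

/-! ### Zigzag cylinders determine a measure. -/

section Cylinders

variable {E : Type*}

/-- The zigzag cylinder of the pairs of lines that read `x` on `[k₁, k₂]` and `y` on `[k₁, k₂)`. -/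
def zigzagCylinder (k₁ k₂ : ℤ) (x y : ℤ → E) : Set ((ℤ → E) × (ℤ → E)) :=
  {p | (∀ i ∈ Set.Icc k₁ k₂, p.1 i = x i) ∧ ∀ i ∈ Set.Ico k₁ k₂, p.2 i = y i}

theorem ext_of_zigzagCylinder [MeasurableSpace E] [MeasurableSingletonClass E] [Fintype E]
    [Nonempty E] {μ ν : Measure ((ℤ → E) × (ℤ → E))}
    [IsProbabilityMeasure μ] [IsProbabilityMeasure ν]
    (h : ∀ k₁ k₂ : ℤ, k₁ < k₂ → ∀ x y : ℤ → E,
      μ.real (zigzagCylinder k₁ k₂ x y) = ν.real (zigzagCylinder k₁ k₂ x y)) : μ = ν := by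
  classical
  -- Nested windows make the preimages a π-system; the extra site on each side keeps the endpoints
  -- distinct when `n = 0`.
  let r (n : ℕ) (p : (ℤ → E) × (ℤ → E)) :
      (Set.Icc (-n - 1 : ℤ) (n + 1) → E) × (Set.Ico (-n - 1 : ℤ) (n + 1) → E) :=
    (fun i => p.1 i, fun i => p.2 i)
  have hr : ∀ n, Measurable (r n) := fun n => by fun_prop
  let C : Set (Set ((ℤ → E) × (ℤ → E))) := {S | ∃ n B, S = r n ⁻¹' B}
  have hext : ∀ n m B, m ≤ n → ∃ B', r m ⁻¹' B = r n ⁻¹' B' := by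
    intro n m B hmn
    exact ⟨(fun q => (fun i => q.1 ⟨i.1, Set.Icc_subset_Icc (by omega) (by omega) i.2⟩,
      fun i => q.2 ⟨i.1, Set.Ico_subset_Ico (by omega) (by omega) i.2⟩)) ⁻¹' B, rfl⟩
  have hpi : IsPiSystem C := by
    rintro _ ⟨n, B, rfl⟩ _ ⟨m, B', rfl⟩ -
    obtain ⟨B₁, h₁⟩ := hext (max n m) n B (le_max_left _ _)
    obtain ⟨B₂, h₂⟩ := hext (max n m) m B' (le_max_right _ _)
    exact ⟨max n m, B₁ ∩ B₂, by rw [h₁, h₂]; rfl⟩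
  have hid : @Measurable _ _ (MeasurableSpace.generateFrom C) inferInstance
      (fun p : (ℤ → E) × (ℤ → E) => (p.1, p.2)) := by
    refine @Measurable.prodMk _ (MeasurableSpace.generateFrom C) _ _ _ _ Prod.fst Prod.snd ?_ ?_
    · refine @measurable_pi_lambda _ _ _ (MeasurableSpace.generateFrom C) _ _ fun i S _ => ?_
      refine MeasurableSpace.measurableSet_generateFrom
        ⟨i.natAbs, {q | q.1 ⟨i, by simp only [Set.mem_Icc]; omega⟩ ∈ S}, rfl⟩
    · refine @measurable_pi_lambda _ _ _ (MeasurableSpace.generateFrom C) _ _ fun i S _ => ?_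
      refine MeasurableSpace.measurableSet_generateFrom
        ⟨i.natAbs, {q | q.2 ⟨i, by simp only [Set.mem_Ico]; omega⟩ ∈ S}, rfl⟩
  have hmap : ∀ n, μ.map (r n) = ν.map (r n) := by
    intro n
    refine Measure.ext_iff_singleton.2 fun q => ?_
    rw [Measure.map_apply (hr n) (MeasurableSet.singleton q),
      Measure.map_apply (hr n) (MeasurableSet.singleton q)]
    obtain ⟨e⟩ := ‹Nonempty E›
    have hq : r n ⁻¹' {q} = zigzagCylinder (-n - 1) (n + 1)
        (fun i => if hi : i ∈ Set.Icc (-n - 1 : ℤ) (n + 1) then q.1 ⟨i, hi⟩ else e)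
        (fun i => if hi : i ∈ Set.Ico (-n - 1 : ℤ) (n + 1) then q.2 ⟨i, hi⟩ else e) := by
      ext p
      simp only [Set.mem_preimage, Set.mem_singleton_iff, zigzagCylinder, Set.mem_ofPred_eq,
        Prod.ext_iff, funext_iff, Subtype.forall, r]
      refine and_congr (forall₂_congr fun i hi => ?_) (forall₂_congr fun i hi => ?_)
      · rw [dif_pos hi]
      · rw [dif_pos hi]
    rw [hq]
    exact (measureReal_eq_measureReal_iff).1 (h _ _ (by omega) _ _)
  refine ext_of_generate_finite C (le_antisymm (fun S hS => hid hS) ?_) hpi ?_ (by simp)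
  · refine MeasurableSpace.generateFrom_le ?_
    rintro _ ⟨n, B, rfl⟩
    exact hr n B.toFinite.measurableSet
  · rintro _ ⟨n, B, rfl⟩
    rw [← Measure.map_apply (hr n) B.toFinite.measurableSet, hmap n,
      Measure.map_apply (hr n) B.toFinite.measurableSet]

variable [MeasurableSpace E] [DiscreteMeasurableSpace E]

theorem measurableSet_forall_eq (J : Set ℤ) (a : ℤ → E) :
    MeasurableSet {w : ℤ → E | ∀ i ∈ J, w i = a i} := by
  have : {w : ℤ → E | ∀ i ∈ J, w i = a i} = J.pi fun i => {a i} := by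
    ext w; simp [Set.mem_pi]
  rw [this]
  exact MeasurableSet.pi (Set.to_countable J) fun i _ => MeasurableSet.singleton _

theorem measurableSet_zigzagCylinder (k₁ k₂ : ℤ) (x y : ℤ → E) :
    MeasurableSet (zigzagCylinder k₁ k₂ x y) :=
  (measurable_fst (measurableSet_forall_eq (Set.Icc k₁ k₂) x)).inter
    (measurable_snd (measurableSet_forall_eq (Set.Ico k₁ k₂) y))

/-- Expansion of the integral of a function of a finite window over the values on the window. -/
theorem integral_window_indicator {Ω : Type*} [MeasurableSpace Ω] {μ : Measure Ω}
    [IsFiniteMeasure μ] {W : Type*} [Fintype W] [MeasurableSpace W] [MeasurableSingletonClass W]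
    {r : Ω → W} (hr : Measurable r) {Y : Set Ω} (hY : MeasurableSet Y) (g : W → ℝ) :
    ∫ p, Y.indicator (fun p => g (r p)) p ∂μ = ∑ w, g w * μ.real (r ⁻¹' {w} ∩ Y) := by
  classical
  have hmeas : ∀ w, MeasurableSet (r ⁻¹' {w} ∩ Y) := fun w =>
    (hr (MeasurableSet.singleton w)).inter hY
  have hpt : ∀ p, Y.indicator (fun p => g (r p)) p
      = ∑ w, (r ⁻¹' {w} ∩ Y).indicator (fun _ => g w) p := by
    intro p
    rw [Finset.sum_eq_single (r p)]
    · by_cases hp : p ∈ Y <;> simp [hp]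
    · intro w _ hw
      refine Set.indicator_of_notMem ?_ _
      rintro ⟨h, -⟩
      exact hw h.symm
    · simp
  simp only [hpt]
  rw [integral_finsetSum _ fun w _ => (integrable_const _).indicator (hmeas w)]
  refine Finset.sum_congr rfl fun w _ => ?_
  rw [integral_indicator_const _ (hmeas w), smul_eq_mul, mul_comm]

end Cylinders

/-! ### The law of two consecutive lines after one step. -/

namespace TPCA

variable {E : Type*} [Fintype E] [MeasurableSpace E] [DiscreteMeasurableSpace E]

theorem localLaw_singleton (A : TPCA E) (y x y' z : E) :
    A.localLaw y x y' {z} = ENNReal.ofReal (A.T y x y' z) := by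
  classical
  simp only [localLaw, Measure.coe_finsetSum, Finset.sum_apply, Measure.smul_apply, smul_eq_mul,
    Measure.dirac_apply, Set.indicator_apply, Set.mem_singleton_iff, Pi.one_apply, mul_ite,
    mul_one, mul_zero, Finset.sum_ite_eq', Finset.mem_univ, if_true]

theorem lineLaw_cylinder (A : TPCA E) (p : (ℤ → E) × (ℤ → E)) (k₁ k₂ : ℤ) (b : ℤ → E) :
    A.lineLaw p {z | ∀ i ∈ Set.Ico k₁ k₂, z i = b i}
      = ENNReal.ofReal
        (∏ i ∈ Finset.Ico k₁ k₂, A.T (p.2 i) (p.1 (i + 1)) (p.2 (i + 1)) (b i)) := by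
  have : {z : ℤ → E | ∀ i ∈ Set.Ico k₁ k₂, z i = b i}
      = (Finset.Ico k₁ k₂ : Set ℤ).pi fun i => {b i} := by
    ext z; simp [Set.mem_pi]
  rw [this, lineLaw, Measure.infinitePi_pi _ fun _ _ => MeasurableSet.singleton _,
    ENNReal.ofReal_prod_of_nonneg fun i _ => A.nonneg _ _ _ _]
  simp only [localLaw_singleton]

instance (A : TPCA E) (μ : Measure ((ℤ → E) × (ℤ → E))) [IsProbabilityMeasure μ] :
    IsProbabilityMeasure (A.step μ) :=
  Measure.isProbabilityMeasure_map (by fun_prop)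

theorem step_zigzagCylinder (A : TPCA E) (μ : Measure ((ℤ → E) × (ℤ → E)))
    [IsProbabilityMeasure μ] (k₁ k₂ : ℤ) (a b : ℤ → E) :
    (A.step μ).real (zigzagCylinder k₁ k₂ a b)
      = ∫ p, (Prod.snd ⁻¹' {z | ∀ i ∈ Set.Icc k₁ k₂, z i = a i}).indicator
          (fun p : (ℤ → E) × (ℤ → E) =>
          ∏ i ∈ Finset.Ico k₁ k₂, A.T (a i) (p.1 (i + 1)) (a (i + 1)) (b i)) p ∂μ := by
  have hm : Measurable fun p : ((ℤ → E) × (ℤ → E)) × (ℤ → E) => (p.1.2, p.2) := by fun_prop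
  have hC := measurableSet_zigzagCylinder k₁ k₂ a b
  have hint : ∀ p : (ℤ → E) × (ℤ → E),
      A.kernel p (Prod.mk p ⁻¹' ((fun p : ((ℤ → E) × (ℤ → E)) × (ℤ → E) => (p.1.2, p.2)) ⁻¹'
        zigzagCylinder k₁ k₂ a b))
      = ENNReal.ofReal ((Prod.snd ⁻¹' {z | ∀ i ∈ Set.Icc k₁ k₂, z i = a i}).indicator
          (fun p : (ℤ → E) × (ℤ → E) =>
          ∏ i ∈ Finset.Ico k₁ k₂, A.T (a i) (p.1 (i + 1)) (a (i + 1)) (b i)) p) := by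
    intro p
    by_cases hp : p ∈ Prod.snd ⁻¹' {z : ℤ → E | ∀ i ∈ Set.Icc k₁ k₂, z i = a i}
    · rw [Set.indicator_of_mem hp]
      simp only [Set.mem_preimage, Set.mem_ofPred_eq] at hp
      have h1 : (Prod.mk p ⁻¹' ((fun p : ((ℤ → E) × (ℤ → E)) × (ℤ → E) => (p.1.2, p.2)) ⁻¹'
        zigzagCylinder k₁ k₂ a b)) = {z | ∀ i ∈ Set.Ico k₁ k₂, z i = b i} := by
        ext z; exact ⟨fun h => h.2, fun h => ⟨hp, h⟩⟩
      rw [h1]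
      refine (A.lineLaw_cylinder p k₁ k₂ b).trans (congrArg _
        (Finset.prod_congr rfl fun i hi => ?_))
      rw [Finset.mem_Ico] at hi
      rw [hp i ⟨hi.1, hi.2.le⟩, hp (i + 1) ⟨by omega, by omega⟩]
    · rw [Set.indicator_of_notMem hp, ENNReal.ofReal_zero]
      have h1 : (Prod.mk p ⁻¹' ((fun p : ((ℤ → E) × (ℤ → E)) × (ℤ → E) => (p.1.2, p.2)) ⁻¹'
        zigzagCylinder k₁ k₂ a b)) = ∅ := by
        ext z; exact ⟨fun h => hp h.1, fun h => h.elim⟩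
      rw [h1, measure_empty]
  have hnn : ∀ p : (ℤ → E) × (ℤ → E),
      0 ≤ (Prod.snd ⁻¹' {z | ∀ i ∈ Set.Icc k₁ k₂, z i = a i}).indicator
          (fun p : (ℤ → E) × (ℤ → E) =>
          ∏ i ∈ Finset.Ico k₁ k₂, A.T (a i) (p.1 (i + 1)) (a (i + 1)) (b i)) p :=
    fun p => Set.indicator_nonneg (fun p _ => Finset.prod_nonneg fun i _ => A.nonneg _ _ _ _) p
  rw [step, measureReal_def, Measure.map_apply hm hC, Measure.compProd_apply (hm hC),
    integral_eq_lintegral_of_nonneg_ae (Filter.Eventually.of_forall hnn)]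
  · simp only [hint]
  · refine (Measurable.indicator ?_ ?_).aestronglyMeasurable
    · refine Finset.measurable_fun_prod _ fun i _ => ?_
      have h1 : Measurable fun x : E => A.T (a i) x (a (i + 1)) (b i) := Measurable.of_discrete
      exact h1.comp (by fun_prop)
    · exact measurable_snd (measurableSet_forall_eq _ a)

/-- The expected rate of writing `z` between `y` and `y'` when the letter below is the midpoint of
a `D`-path from `y` to `y'`. -/
noncomputable def bridgeRate (A : TPCA E) (D : Matrix E E ℝ) (y y' z : E) : ℝ :=
  ∑ x, D y x * D x y' * A.T y x y' z

/-- Once the second line is fixed to `a`, the weight is a product of functions of single letters of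
the first line, so the sum factorizes. Site `k₁` gives `ρ k₁ ᵥ* D`, the inner sites give bridge
rates, and site `k₂ + 1`, present only because the zigzag must reach beyond `a k₂`, sums to `1`. -/
theorem step_zigzagCylinder_of_chain (A : TPCA E) {D : Matrix E E ℝ} (hD1 : ∀ x, ∑ y, D x y = 1)
    {μ : Measure ((ℤ → E) × (ℤ → E))} [IsProbabilityMeasure μ] {ρ : ℤ → E → ℝ}
    (hμ : ∀ k₁ k₂ : ℤ, k₁ < k₂ → ∀ x y : ℤ → E, μ.real (zigzagCylinder k₁ k₂ x y)
      = ρ k₁ (x k₁) * ∏ i ∈ Finset.Ico k₁ k₂, D (x i) (y i) * D (y i) (x (i + 1)))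
    {k₁ k₂ : ℤ} (hk : k₁ ≤ k₂) (a b : ℤ → E) :
    (A.step μ).real (zigzagCylinder k₁ k₂ a b)
      = (ρ k₁ ᵥ* D) (a k₁) * ∏ i ∈ Finset.Ico k₁ k₂, A.bridgeRate D (a i) (a (i + 1)) (b i) := by
  classical
  set J := Finset.Icc k₁ (k₂ + 1) with hJ
  -- The total weight of the letter `v` at site `j`; an inner site also absorbs the rate `T` that
  -- reads it.
  let f (j : ℤ) (v : E) : ℝ :=
    if j = k₁ then ρ k₁ v * D v (a k₁)
    else if j = k₂ + 1 then D (a (j - 1)) v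
    else D (a (j - 1)) v * D v (a j) * A.T (a (j - 1)) v (a j) (b (j - 1))
  let ext (w : J → E) (i : ℤ) : E := if hi : i ∈ J then w ⟨i, hi⟩ else a i
  have hr : Measurable fun (p : (ℤ → E) × (ℤ → E)) (j : J) => p.1 j := by fun_prop
  let g (w : J → E) : ℝ :=
    ∏ i ∈ Finset.Ico k₁ k₂, A.T (a i) (ext w (i + 1)) (a (i + 1)) (b i)
  have hterm : ∀ x : ℤ → E,
      (∏ i ∈ Finset.Ico k₁ k₂, A.T (a i) (x (i + 1)) (a (i + 1)) (b i)) *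
        (ρ k₁ (x k₁) * ∏ i ∈ Finset.Ico k₁ (k₂ + 1), D (x i) (a i) * D (a i) (x (i + 1)))
      = ∏ j ∈ J, f j (x j) := by
    intro x
    rw [hJ, prod_Icc_add_one_eq_mul hk, Finset.prod_mul_distrib,
      prod_Ico_add_one_right_eq_mul_shift hk fun i => D (x i) (a i),
      prod_Ico_add_one_right_eq_mul hk fun i => D (a i) (x (i + 1))]
    have h1 : ∏ i ∈ Finset.Ico k₁ k₂, f (i + 1) (x (i + 1))
        = (∏ i ∈ Finset.Ico k₁ k₂, D (a i) (x (i + 1))) *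
          (∏ i ∈ Finset.Ico k₁ k₂, D (x (i + 1)) (a (i + 1))) *
          ∏ i ∈ Finset.Ico k₁ k₂, A.T (a i) (x (i + 1)) (a (i + 1)) (b i) := by
      rw [← Finset.prod_mul_distrib, ← Finset.prod_mul_distrib]
      refine Finset.prod_congr rfl fun i hi => ?_
      rw [Finset.mem_Ico] at hi
      simp only [f]
      rw [if_neg (by omega), if_neg (by omega), add_sub_cancel_right]
    rw [h1]
    simp only [f, if_true]
    rw [if_neg (by omega), add_sub_cancel_right]
    ring
  rw [step_zigzagCylinder]
  have hcongr : (fun p : (ℤ → E) × (ℤ → E) =>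
      (Prod.snd ⁻¹' {z | ∀ i ∈ Set.Icc k₁ k₂, z i = a i}).indicator
        (fun p : (ℤ → E) × (ℤ → E) =>
          ∏ i ∈ Finset.Ico k₁ k₂, A.T (a i) (p.1 (i + 1)) (a (i + 1)) (b i)) p)
      = fun p => (Prod.snd ⁻¹' {z | ∀ i ∈ Set.Icc k₁ k₂, z i = a i}).indicator
        (fun p : (ℤ → E) × (ℤ → E) => g fun j => p.1 j) p := by
    funext p
    congr 1
    funext p
    refine Finset.prod_congr rfl fun i hi => ?_
    rw [Finset.mem_Ico] at hi
    simp only [ext]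
    rw [dif_pos (by rw [hJ, Finset.mem_Icc]; omega)]
  rw [hcongr, integral_window_indicator hr (measurable_snd (measurableSet_forall_eq _ a))]
  have hset : ∀ w : J → E,
      (fun (p : (ℤ → E) × (ℤ → E)) (j : J) => p.1 j) ⁻¹' {w} ∩
        (Prod.snd ⁻¹' {z | ∀ i ∈ Set.Icc k₁ k₂, z i = a i})
      = zigzagCylinder k₁ (k₂ + 1) (ext w) a := by
    intro w
    ext p
    simp only [Set.mem_inter_iff, Set.mem_preimage, Set.mem_singleton_iff, funext_iff,
      Subtype.forall, Set.mem_ofPred_eq, zigzagCylinder, ext, Set.mem_Icc, Set.mem_Ico]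
    refine and_congr (forall_congr' fun i => ?_) (forall_congr' fun i => ?_)
    · simp only [hJ, Finset.mem_Icc]
      refine forall_congr' fun hi => ?_
      rw [dif_pos hi]
    · rw [Int.lt_add_one_iff]
  have hsum : ∀ w : J → E, g w * μ.real ((fun (p : (ℤ → E) × (ℤ → E)) (j : J) => p.1 j) ⁻¹' {w} ∩
        (Prod.snd ⁻¹' {z | ∀ i ∈ Set.Icc k₁ k₂, z i = a i})) = ∏ j : J, f j (w j) := by
    intro w
    rw [hset, hμ _ _ (by omega), hterm, ← Finset.prod_coe_sort]
    refine Finset.prod_congr rfl fun j _ => ?_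
    simp only [ext]
    rw [dif_pos j.2]
  refine (Finset.sum_congr rfl fun w _ => hsum w).trans ?_
  rw [← Fintype.piFinset_univ, ← Finset.prod_univ_sum, Finset.prod_coe_sort J fun j => ∑ v, f j v,
    hJ, prod_Icc_add_one_eq_mul hk]
  have h1 : ∑ v, f k₁ v = (ρ k₁ ᵥ* D) (a k₁) := by
    simp only [f, if_true]; rfl
  have h2 : ∑ v, f (k₂ + 1) v = 1 := by
    simp only [f, if_true, if_neg (show ¬ k₂ + 1 = k₁ by omega), add_sub_cancel_right]
    exact hD1 _
  rw [h1, h2, mul_one]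
  congr 1
  refine Finset.prod_congr rfl fun i hi => ?_
  rw [Finset.mem_Ico] at hi
  simp only [f, bridgeRate, if_neg (show ¬ i + 1 = k₁ by omega),
    if_neg (show ¬ i + 1 = k₂ + 1 by omega), add_sub_cancel_right]

end TPCA

/-! ### The two-sided stationary Markov chain. -/

section Chain

variable {E : Type*}

/-- A cylinder of a two-sided sequence, together with the value at one more site. -/
theorem cylinder_inter_eq (J : Set ℤ) {j : ℤ} (hj : j ∉ J) (a : ℤ → E) (c : E) :
    {w : ℤ → E | ∀ i ∈ J, w i = a i} ∩ (fun w => w j) ⁻¹' {c}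
      = {w : ℤ → E | ∀ i ∈ insert j J, w i = Function.update a j c i} := by
  ext w
  simp only [Set.mem_inter_iff, Set.mem_ofPred_eq, Set.mem_preimage, Set.mem_singleton_iff,
    Set.mem_insert_iff, forall_eq_or_imp, Function.update_self]
  rw [and_comm]
  refine and_congr_right fun _ => forall₂_congr fun i hi => ?_
  rw [Function.update_of_ne (ne_of_mem_of_not_mem hi hj)]

variable [Fintype E]

theorem measureReal_cylinder_eq_sum [MeasurableSpace E] [DiscreteMeasurableSpace E]
    (Q : Measure (ℤ → E)) [IsProbabilityMeasure Q] (J : Set ℤ) {j : ℤ} (hj : j ∉ J) (a : ℤ → E) :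
    Q.real {w | ∀ i ∈ J, w i = a i}
      = ∑ c, Q.real {w | ∀ i ∈ insert j J, w i = Function.update a j c i} := by
  have hm : Measurable fun w : ℤ → E => w j := measurable_pi_apply j
  have h := sum_measureReal_preimage_singleton
    (μ := Q.restrict {w | ∀ i ∈ J, w i = a i}) Finset.univ (f := fun w : ℤ → E => w j)
    fun c _ => hm (MeasurableSet.singleton c)
  simp only [Finset.coe_univ, Set.preimage_univ, measureReal_restrict_apply_univ] at h
  rw [← h]
  refine Finset.sum_congr rfl fun c _ => ?_
  rw [measureReal_restrict_apply (hm (MeasurableSet.singleton c)), Set.inter_comm,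
    cylinder_inter_eq J hj]

/-- `Q` gives the cylinders over `[m, n]` their weight under the chain with transition matrix `D`
started from `π`. -/
def IsChainOn [MeasurableSpace E] (D : Matrix E E ℝ) (π : E → ℝ) (m n : ℤ)
    (Q : Measure (ℤ → E)) : Prop :=
  ∀ a : ℤ → E, Q.real {w | ∀ i ∈ Set.Icc m n, w i = a i}
    = π (a m) * ∏ i ∈ Finset.Ico m n, D (a i) (a (i + 1))

section

variable [MeasurableSpace E] [DiscreteMeasurableSpace E] {D : Matrix E E ℝ} {π : E → ℝ}
  {Q : Measure (ℤ → E)} [IsProbabilityMeasure Q] {m n : ℤ}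

theorem IsChainOn.of_add_one_right (h : IsChainOn D π m (n + 1) Q) (hmn : m ≤ n)
    (hD1 : ∀ x, ∑ y, D x y = 1) : IsChainOn D π m n Q := by
  intro a
  have hins : insert (n + 1) (Set.Icc m n) = Set.Icc m (n + 1) := by
    ext i; simp only [Set.mem_insert_iff, Set.mem_Icc]; omega
  rw [measureReal_cylinder_eq_sum Q (Set.Icc m n) (j := n + 1) (by simp)]
  simp only [hins]
  have hc : ∀ c, Q.real {w | ∀ i ∈ Set.Icc m (n + 1), w i = Function.update a (n + 1) c i}
      = π (a m) * (∏ i ∈ Finset.Ico m n, D (a i) (a (i + 1))) * D (a n) c := by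
    intro c
    rw [h, prod_Ico_add_one_right_eq_mul hmn, Function.update_of_ne (by omega),
      Function.update_of_ne (by omega), Function.update_self, mul_assoc]
    congr 2
    refine Finset.prod_congr rfl fun i hi => ?_
    rw [Finset.mem_Ico] at hi
    rw [Function.update_of_ne (by omega), Function.update_of_ne (by omega)]
  simp only [hc, ← Finset.mul_sum, hD1, mul_one]

theorem IsChainOn.of_add_one_left (h : IsChainOn D π m (n + 1) Q) (hmn : m ≤ n)
    (hπ : π ᵥ* D = π) : IsChainOn D π (m + 1) (n + 1) Q := by
  intro a
  have hins : insert m (Set.Icc (m + 1) (n + 1)) = Set.Icc m (n + 1) := by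
    ext i; simp only [Set.mem_insert_iff, Set.mem_Icc]; omega
  rw [measureReal_cylinder_eq_sum Q (Set.Icc (m + 1) (n + 1)) (j := m) (by simp)]
  simp only [hins]
  have hshift : ∏ i ∈ Finset.Ico (m + 1) (n + 1), D (a i) (a (i + 1))
      = ∏ i ∈ Finset.Ico m n, D (a (i + 1)) (a (i + 1 + 1)) :=
    (Finset.prod_Ico_add' (fun i => D (a i) (a (i + 1))) m n 1).symm
  have hc : ∀ c, Q.real {w | ∀ i ∈ Set.Icc m (n + 1), w i = Function.update a m c i}
      = π c * D c (a (m + 1)) * ∏ i ∈ Finset.Ico (m + 1) (n + 1), D (a i) (a (i + 1)) := by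
    intro c
    rw [h, prod_Ico_add_one_right_eq_mul_shift hmn, Function.update_self,
      Function.update_of_ne (by omega), hshift, mul_assoc]
    congr 2
    refine Finset.prod_congr rfl fun i hi => ?_
    rw [Finset.mem_Ico] at hi
    rw [Function.update_of_ne (by omega), Function.update_of_ne (by omega)]
  simp only [hc, ← Finset.sum_mul]
  congr 1
  exact congrFun hπ _

/-- Trimming on the right uses that rows sum to `1`; trimming on the left uses stationarity of `π`.
-/
theorem IsChainOn.mono (h : IsChainOn D π m n Q) (hD1 : ∀ x, ∑ y, D x y = 1) (hπ : π ᵥ* D = π)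
    {m' n' : ℤ} (hm : m ≤ m') (hmn : m' ≤ n') (hn : n' ≤ n) : IsChainOn D π m' n' Q := by
  have h1 : IsChainOn D π m n' Q := by
    induction n, hn using Int.leInduction with
    | base => exact h
    | succ k hk ih => exact ih (h.of_add_one_right (by omega) hD1)
  clear h hn
  induction m', hm using Int.leInduction with
  | base => exact h1
  | succ k hk ih =>
    have h2 := ih (by omega)
    obtain ⟨p, rfl⟩ : ∃ p, n' = p + 1 := ⟨n' - 1, by omega⟩
    exact h2.of_add_one_left (by omega) hπ

end

/-- The law on the alphabet given by a probability vector. -/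
noncomputable def pmfOfVector (v : E → ℝ) (hv : v ∈ stdSimplex ℝ E) : PMF E :=
  PMF.ofFintype (fun x => ENNReal.ofReal (v x)) (by
    rw [← ENNReal.ofReal_sum_of_nonneg fun i _ => hv.1 i, hv.2, ENNReal.ofReal_one])

theorem exists_isChainOn_add_natCast [MeasurableSpace E] [DiscreteMeasurableSpace E]
    {D : Matrix E E ℝ} {π : E → ℝ} (hD : ∀ x, D x ∈ stdSimplex ℝ E) (hπ : π ∈ stdSimplex ℝ E)
    (s : ℤ) (L : ℕ) : ∃ p : PMF (ℤ → E), ∀ a : ℤ → E,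
      p.toOuterMeasure {w | ∀ i ∈ Set.Icc s (s + L), w i = a i}
        = ENNReal.ofReal (π (a s) * ∏ i ∈ Finset.Ico s (s + L), D (a i) (a (i + 1))) := by
  classical
  induction L with
  | zero =>
    refine ⟨(pmfOfVector π hπ).map fun x _ => x, fun a => ?_⟩
    have : (fun (x : E) (_ : ℤ) => x) ⁻¹' {w | ∀ i ∈ Set.Icc s (s + (0 : ℕ)), w i = a i}
        = {a s} := by
      ext x; simp
    rw [PMF.toOuterMeasure_map_apply, this, PMF.toOuterMeasure_apply_singleton]
    simp [pmfOfVector]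
  | succ L ih =>
    obtain ⟨p, hp⟩ := ih
    -- Append one letter drawn from the row of `D` at the last letter; letters outside the window
    -- are irrelevant.
    refine ⟨p.bind fun w => (pmfOfVector (D (w (s + L))) (hD _)).map
      (Function.update w (s + L + 1)), fun a => ?_⟩
    have hpt : ∀ w : ℤ → E, p w * ((pmfOfVector (D (w (s + L))) (hD _)).map
        (Function.update w (s + L + 1))).toOuterMeasure
          {w | ∀ i ∈ Set.Icc s (s + (L + 1 : ℕ)), w i = a i}
        = Set.indicator {w | ∀ i ∈ Set.Icc s (s + L), w i = a i} p w
          * ENNReal.ofReal (D (a (s + L)) (a (s + L + 1))) := by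
      intro w
      rw [PMF.toOuterMeasure_map_apply]
      by_cases hw : w ∈ {w : ℤ → E | ∀ i ∈ Set.Icc s (s + L), w i = a i}
      · rw [Set.indicator_of_mem hw]
        rw [Set.mem_ofPred_eq] at hw
        have : Function.update w (s + L + 1) ⁻¹'
            {w | ∀ i ∈ Set.Icc s (s + (L + 1 : ℕ)), w i = a i} = {a (s + L + 1)} := by
          ext x
          simp only [Set.mem_preimage, Set.mem_ofPred_eq, Set.mem_singleton_iff]
          constructor
          · intro h
            simpa using h (s + L + 1) ⟨by omega, by push_cast; omega⟩
          · rintro rfl i hi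
            rw [Set.mem_Icc] at hi
            push_cast at hi
            rcases eq_or_ne i (s + L + 1) with rfl | h
            · simp
            · rw [Function.update_of_ne h]
              exact hw i ⟨hi.1, by omega⟩
        rw [this, PMF.toOuterMeasure_apply_singleton, hw (s + L) ⟨by omega, le_rfl⟩]
        rfl
      · rw [Set.indicator_of_notMem hw, zero_mul]
        have : Function.update w (s + L + 1) ⁻¹'
            {w | ∀ i ∈ Set.Icc s (s + (L + 1 : ℕ)), w i = a i} = ∅ := by
          ext x
          simp only [Set.mem_preimage, Set.mem_ofPred_eq, Set.mem_empty_iff_false, iff_false]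
          intro h
          refine hw fun i hi => ?_
          rw [Set.mem_Icc] at hi
          have := h i ⟨hi.1, by push_cast; omega⟩
          rwa [Function.update_of_ne (by omega)] at this
        rw [this, measure_empty, mul_zero]
    rw [PMF.toOuterMeasure_bind_apply, tsum_congr hpt, ENNReal.tsum_mul_right,
      ← PMF.toOuterMeasure_apply, hp, ← ENNReal.ofReal_mul]
    · push_cast
      rw [← add_assoc, prod_Ico_add_one_right_eq_mul (by omega), mul_assoc]
    · exact mul_nonneg (hπ.1 _) (Finset.prod_nonneg fun i _ => (hD _).1 _)

theorem exists_isChainOn [MeasurableSpace E] [DiscreteMeasurableSpace E]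
    {D : Matrix E E ℝ} {π : E → ℝ} (hD : ∀ x, D x ∈ stdSimplex ℝ E) (hπ : π ∈ stdSimplex ℝ E)
    {m n : ℤ} (hmn : m ≤ n) :
    ∃ Q : Measure (ℤ → E), IsProbabilityMeasure Q ∧ IsChainOn D π m n Q := by
  obtain ⟨p, hp⟩ := exists_isChainOn_add_natCast hD hπ m (n - m).toNat
  refine ⟨p.toMeasure, inferInstance, fun a => ?_⟩
  have h := hp a
  rw [show m + ((n - m).toNat : ℤ) = n by omega] at h
  rw [measureReal_def, PMF.toMeasure_apply_eq_toOuterMeasure_apply _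
    (measurableSet_forall_eq _ a), h, ENNReal.toReal_ofReal]
  exact mul_nonneg (hπ.1 _) (Finset.prod_nonneg fun i _ => (hD _).1 _)

/-- The two-sided stationary Markov chain on a finite alphabet exists. -/
theorem exists_isChainOn_forall [MeasurableSpace E] [DiscreteMeasurableSpace E]
    {D : Matrix E E ℝ} {π : E → ℝ} (hD : ∀ x, D x ∈ stdSimplex ℝ E) (hπ : π ∈ stdSimplex ℝ E)
    (hπD : π ᵥ* D = π) :
    ∃ Q : Measure (ℤ → E), IsProbabilityMeasure Q ∧ ∀ m n, m ≤ n → IsChainOn D π m n Q := by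
  classical
  let _ : TopologicalSpace E := ⊥
  have _ : DiscreteTopology E := ⟨rfl⟩
  have _ : BorelSpace E := ⟨by
    rw [borel_eq_top_of_discrete]
    exact top_le_iff.1 fun s _ => MeasurableSet.of_discrete⟩
  choose Q hQ hQc using fun n : ℕ => exists_isChainOn hD hπ (m := -n) (n := n) (by omega)
  let Q' (n : ℕ) : ProbabilityMeasure (ℤ → E) := ⟨Q n, hQ n⟩
  -- Probability measures on the compact space `ℤ → E` form a compact space, so the finite-window
  -- laws converge along an ultrafilter. Cylinders are clopen, and their masses are eventually
  -- constant.
  let U : Ultrafilter (ProbabilityMeasure (ℤ → E)) := (Filter.hyperfilter ℕ).map Q'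
  have hlim : Filter.Tendsto Q' (Filter.hyperfilter ℕ) (nhds U.lim) := U.le_nhds_lim
  refine ⟨U.lim, inferInstance, fun m n hmn a => ?_⟩
  have hclopen : IsClopen {w : ℤ → E | ∀ i ∈ Set.Icc m n, w i = a i} := by
    have : {w : ℤ → E | ∀ i ∈ Set.Icc m n, w i = a i}
        = ⋂ i ∈ Set.Icc m n, (fun w : ℤ → E => w i) ⁻¹' {a i} := by
      ext w; simp
    rw [this]
    exact (Set.finite_Icc m n).isClopen_biInter fun i _ =>
      (isClopen_discrete _).preimage (continuous_apply i)
  have ht := ProbabilityMeasure.tendsto_measure_of_isClopen_of_tendsto hlim hclopen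
  have ht' : Filter.Tendsto (fun k => (Q k).real {w : ℤ → E | ∀ i ∈ Set.Icc m n, w i = a i})
      (Filter.hyperfilter ℕ)
      (nhds ((U.lim : Measure (ℤ → E)).real {w : ℤ → E | ∀ i ∈ Set.Icc m n, w i = a i})) :=
    (NNReal.continuous_coe.tendsto _).comp ht
  refine tendsto_nhds_unique ht' (Filter.Tendsto.congr' ?_ tendsto_const_nhds)
  have : ∀ᶠ k : ℕ in Filter.atTop, (-k : ℤ) ≤ m ∧ n ≤ k :=
    Filter.eventually_atTop.2 ⟨max m.natAbs n.natAbs, fun k hk => by omega⟩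
  filter_upwards [Nat.hyperfilter_le_atTop this] with k hk
  exact ((hQc k).mono hD1 hπD hk.1 hmn hk.2 a).symm
where
  hD1 := fun x => (hD x).2

end Chain

/-! ### Contraction, and rigidity of two-sided orbits. -/

section Uniqueness

variable {E : Type*} [Fintype E]

/-- One step of a stochastic matrix bounded below by `ε` contracts the `ℓ¹` distance. -/
theorem sum_abs_vecMul_sub_le {P : Matrix E E ℝ} (hP1 : ∀ x, ∑ y, P x y = 1) {ε : ℝ}
    (hε : ∀ x y, ε ≤ P x y) {u v : E → ℝ} (hu : u ∈ stdSimplex ℝ E) (hv : v ∈ stdSimplex ℝ E) :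
    ∑ y, |(u ᵥ* P) y - (v ᵥ* P) y| ≤ (1 - Fintype.card E * ε) * ∑ x, |u x - v x| := by
  -- Subtracting the constant `ε` costs nothing, as `u` and `v` have equal mass.
  have hd : ∀ y, (u ᵥ* P) y - (v ᵥ* P) y = ∑ x, (u x - v x) * (P x y - ε) := by
    intro y
    simp only [mul_sub, sub_mul, Finset.sum_sub_distrib, ← Finset.sum_mul, hu.2, hv.2]
    simp only [Matrix.vecMul, dotProduct]
    ring
  calc ∑ y, |(u ᵥ* P) y - (v ᵥ* P) y| ≤ ∑ y, ∑ x, |u x - v x| * (P x y - ε) := by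
        refine Finset.sum_le_sum fun y _ => ?_
        rw [hd]
        refine (Finset.abs_sum_le_sum_abs _ _).trans (Finset.sum_le_sum fun x _ => ?_)
        rw [abs_mul, abs_of_nonneg (sub_nonneg.2 (hε x y))]
    _ = (1 - Fintype.card E * ε) * ∑ x, |u x - v x| := by
        rw [Finset.sum_comm]
        simp only [← Finset.mul_sum, Finset.sum_sub_distrib, hP1, Finset.sum_const,
          Finset.card_univ, nsmul_eq_mul, ← Finset.sum_mul]
        ring

/-- The only two-sided orbit of probability vectors under a positive stochastic matrix is the
stationary one. -/
theorem eq_of_forall_vecMul [Nonempty E] {P : Matrix E E ℝ} (hP : ∀ x y, 0 < P x y)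
    (hP1 : ∀ x, ∑ y, P x y = 1) {ρ σ : ℤ → E → ℝ} (hρ : ∀ k, ρ k ∈ stdSimplex ℝ E)
    (hσ : ∀ k, σ k ∈ stdSimplex ℝ E) (hρP : ∀ k, ρ (k + 1) = ρ k ᵥ* P)
    (hσP : ∀ k, σ (k + 1) = σ k ᵥ* P) (k : ℤ) : ρ k = σ k := by
  obtain ⟨⟨x₀, y₀⟩, hmin⟩ := Finite.exists_min fun p : E × E => P p.1 p.2
  set ε := P x₀ y₀
  have hε : ∀ x y, ε ≤ P x y := fun x y => hmin (x, y)
  set c := 1 - Fintype.card E * ε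
  have hc1 : c < 1 := by
    have : 0 < (Fintype.card E : ℝ) * ε :=
      mul_pos (Nat.cast_pos.2 Fintype.card_pos) (hP x₀ y₀)
    simp only [c]; linarith
  have hc0 : 0 ≤ c := by
    have h : ∑ _y : E, ε ≤ 1 := hP1 x₀ ▸ Finset.sum_le_sum fun y _ => hε x₀ y
    rw [Finset.sum_const, Finset.card_univ, nsmul_eq_mul] at h
    simp only [c]; linarith
  -- Start `n` steps in the past, where the distance is at most `2`; each step contracts by `c`,
  -- uniformly in `k`.
  have hbound : ∀ (n : ℕ) (k : ℤ), ∑ x, |ρ k x - σ k x| ≤ c ^ n * 2 := by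
    intro n
    induction n with
    | zero =>
      intro k
      calc ∑ x, |ρ k x - σ k x| ≤ ∑ x, (ρ k x + σ k x) := Finset.sum_le_sum fun x _ => by
            have h1 := (hρ k).1 x
            have h2 := (hσ k).1 x
            rw [abs_le]; constructor <;> linarith
        _ = c ^ 0 * 2 := by rw [Finset.sum_add_distrib, (hρ k).2, (hσ k).2]; norm_num
    | succ n ih =>
      intro k
      have h := sum_abs_vecMul_sub_le hP1 hε (hρ (k - 1)) (hσ (k - 1))
      rw [← hρP, ← hσP, sub_add_cancel] at h
      calc _ ≤ _ := h
        _ ≤ c * (c ^ n * 2) := mul_le_mul_of_nonneg_left (ih _) hc0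
        _ = c ^ (n + 1) * 2 := by ring
  have hlim : Filter.Tendsto (fun n : ℕ => c ^ n * 2) Filter.atTop (nhds 0) := by
    simpa using (tendsto_pow_atTop_nhds_zero_of_lt_one hc0 hc1).mul_const 2
  have h0 : ∑ x, |ρ k x - σ k x| ≤ 0 := ge_of_tendsto' hlim fun n => hbound n k
  have h1 := (Finset.sum_eq_zero_iff_of_nonneg fun x _ => abs_nonneg _).1
    (le_antisymm h0 (Finset.sum_nonneg fun x _ => abs_nonneg (ρ k x - σ k x)))
  ext x
  exact sub_eq_zero.1 (abs_eq_zero.1 (h1 x (Finset.mem_univ x)))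

end Uniqueness

/-! ### Existence and uniqueness of the HZMC distribution. -/

section Existence

variable {E : Type*}

theorem prod_Ico_zigzag (D : Matrix E E ℝ) (x y c : ℤ → E) (hx : ∀ i, c (2 * i) = x i)
    (hy : ∀ i, c (2 * i + 1) = y i) {k₁ k₂ : ℤ} (hk : k₁ ≤ k₂) :
    ∏ i ∈ Finset.Ico (2 * k₁) (2 * k₂), D (c i) (c (i + 1))
      = ∏ i ∈ Finset.Ico k₁ k₂, D (x i) (y i) * D (y i) (x (i + 1)) := by
  induction k₂, hk using Int.leInduction with
  | base => simp
  | succ k hk ih =>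
    rw [show 2 * (k + 1) = 2 * k + 1 + 1 by ring, prod_Ico_add_one_right_eq_mul (by omega),
      prod_Ico_add_one_right_eq_mul (by omega), prod_Ico_add_one_right_eq_mul hk, ih, hx, hy,
      show 2 * k + 1 + 1 = 2 * (k + 1) by ring, hx, mul_assoc]

variable [Fintype E] [DecidableEq E] [MeasurableSpace E] [DiscreteMeasurableSpace E]

theorem exists_isHZMC [Nonempty E] {D : Matrix E E ℝ} (hD : ∀ x y, 0 < D x y)
    (hD1 : ∀ x, ∑ y, D x y = 1) : ∃ μ, IsHZMC D D μ := by
  obtain ⟨π, ⟨hπ, hπD⟩, -⟩ := existsUnique_isStationaryVector hD hD1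
  obtain ⟨Q, hQ, hQc⟩ := exists_isChainOn_forall (D := D)
    (fun x => ⟨fun y => (hD x y).le, hD1 x⟩) hπ hπD
  let F (w : ℤ → E) : (ℤ → E) × (ℤ → E) := (fun i => w (2 * i), fun i => w (2 * i + 1))
  have hF : Measurable F := by fun_prop
  have hmem : D ∈ Matrix.rowStochastic ℝ E :=
    Matrix.mem_rowStochastic_iff_sum.2 ⟨fun x y => (hD x y).le, hD1⟩
  refine ⟨Q.map F, hmem, hmem, Measure.isProbabilityMeasure_map hF.aemeasurable, fun _ => π,
    fun _ => hπ, fun _ x' => ?_, fun k₁ k₂ hk x y => ?_⟩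
  · have h : π ᵥ* (D * D) = π := by rw [← Matrix.vecMul_vecMul, hπD, hπD]
    exact (congrFun h x').symm
  · let c (j : ℤ) : E := if j % 2 = 0 then x (j / 2) else y (j / 2)
    have hx : ∀ i, c (2 * i) = x i := fun i => by
      simp only [c]
      rw [if_pos (by omega), show 2 * i / 2 = i by omega]
    have hy : ∀ i, c (2 * i + 1) = y i := fun i => by
      simp only [c]
      rw [if_neg (by omega), show (2 * i + 1) / 2 = i by omega]
    have hpre : F ⁻¹' zigzagCylinder k₁ k₂ x y
        = {w | ∀ i ∈ Set.Icc (2 * k₁) (2 * k₂), w i = c i} := by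
      ext w
      simp only [zigzagCylinder, Set.mem_preimage, Set.mem_ofPred_eq, F, Set.mem_Icc, Set.mem_Ico]
      constructor
      · rintro ⟨h1, h2⟩ i hi
        rcases Int.even_or_odd' i with ⟨j, rfl | rfl⟩
        · rw [hx]; exact h1 j (by omega)
        · rw [hy]; exact h2 j (by omega)
      · intro h
        exact ⟨fun i hi => (h (2 * i) (by omega)).trans (hx i),
          fun i hi => (h (2 * i + 1) (by omega)).trans (hy i)⟩
    have h := hQc (2 * k₁) (2 * k₂) (by omega) c
    rw [← hpre, hx, prod_Ico_zigzag D x y c hx hy hk.le] at h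
    rw [← h]
    exact map_measureReal_apply hF (measurableSet_zigzagCylinder k₁ k₂ x y)

theorem IsHZMC.unique [Nonempty E] {D : Matrix E E ℝ} (hD : ∀ x y, 0 < D x y)
    {μ ν : Measure ((ℤ → E) × (ℤ → E))} (hμ : IsHZMC D D μ) (hν : IsHZMC D D ν) : μ = ν := by
  obtain ⟨hDs, -, hμp, ρ, hρ, hρD, hμc⟩ := hμ
  obtain ⟨-, -, hνp, σ, hσ, hσD, hνc⟩ := hν
  have hDD : D * D ∈ Matrix.rowStochastic ℝ E := mul_mem hDs hDs
  have hρσ := eq_of_forall_vecMul (SPCA.mul_self_pos hD)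
    (Matrix.mem_rowStochastic_iff_sum.1 hDD).2 hρ hσ (fun k => funext (hρD k))
    fun k => funext (hσD k)
  refine ext_of_zigzagCylinder fun k₁ k₂ hk x y => ?_
  refine (hμc k₁ k₂ hk x y).trans (Eq.trans ?_ (hνc k₁ k₂ hk x y).symm)
  rw [hρσ]

end Existence

/-! ### Invariance is the bridge identity. -/

namespace TPCA

variable {E : Type*} [Fintype E]

theorem existsUnique_tilde [Nonempty E] (A : TPCA E) (hpos : ∀ y x y' z, 0 < A.T y x y' z)
    (y y' : E) : ∃! v : E → ℝ, IsStationaryVector (A.sliceMatrix y y') v :=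
  existsUnique_isStationaryVector (fun x z => hpos y x y' z) fun x => A.sum_eq_one y x y'

theorem isStationaryVector_tilde [Nonempty E] (A : TPCA E)
    (hpos : ∀ y x y' z, 0 < A.T y x y' z) (y y' : E) :
    IsStationaryVector (A.sliceMatrix y y') (A.tilde y y') :=
  isStationaryVector_stationaryVector (A.existsUnique_tilde hpos y y')

theorem tilde_pos [Nonempty E] (A : TPCA E) (hpos : ∀ y x y' z, 0 < A.T y x y' z)
    (y y' z : E) : 0 < A.tilde y y' z :=
  (A.isStationaryVector_tilde hpos y y').pos (fun x z => hpos y x y' z) z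

theorem sum_tilde [Nonempty E] (A : TPCA E) (hpos : ∀ y x y' z, 0 < A.T y x y' z)
    (y y' : E) : ∑ z, A.tilde y y' z = 1 :=
  (A.isStationaryVector_tilde hpos y y').1.2

/-- After division by `(D * D) y y'`, the rate identity says that the bridge law is stationary for
`sliceMatrix y y'`, whose stationary vector is unique. -/
theorem isBridgeKernel_tilde_iff [Nonempty E] (A : TPCA E) (hpos : ∀ y x y' z, 0 < A.T y x y' z)
    {D : Matrix E E ℝ} (hD : ∀ x y, 0 < D x y) :
    SPCA.IsBridgeKernel D A.tilde ↔ ∀ y y' z, A.bridgeRate D y y' z = D y z * D z y' := by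
  constructor
  · intro h y y' z
    have h1 : ∑ x, A.tilde y y' x * A.T y x y' z = A.tilde y y' z :=
      congrFun (A.isStationaryVector_tilde hpos y y').2 z
    simp only [bridgeRate, h y y' _, mul_assoc, ← Finset.mul_sum, h1]
  · intro h y y' z
    have h0 := SPCA.mul_self_pos hD y y'
    have hv : IsStationaryVector (A.sliceMatrix y y')
        fun x => D y x * D x y' / (D * D) y y' := by
      refine ⟨⟨fun x => div_nonneg (mul_pos (hD y x) (hD x y')).le h0.le, ?_⟩, ?_⟩
      · rw [← Finset.sum_div]
        exact div_self h0.ne'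
      · ext z
        change ∑ x, D y x * D x y' / (D * D) y y' * A.T y x y' z = _
        simp only [div_mul_eq_mul_div, ← Finset.sum_div]
        rw [← h y y' z]
        rfl
    rw [← (A.existsUnique_tilde hpos y y').unique hv (A.isStationaryVector_tilde hpos y y')]
    field_simp

variable [MeasurableSpace E] [DiscreteMeasurableSpace E] [DecidableEq E]

theorem isInvariant_of_isBridgeKernel [Nonempty E] (A : TPCA E)
    (hpos : ∀ y x y' z, 0 < A.T y x y' z) {D : Matrix E E ℝ} (hD : ∀ x y, 0 < D x y)
    (hDK : SPCA.IsBridgeKernel D A.tilde) {μ : Measure ((ℤ → E) × (ℤ → E))}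
    (hμ : IsHZMC D D μ) : A.IsInvariant μ := by
  obtain ⟨hDs, -, hμp, ρ, hρ, hρD, hμc⟩ := hμ
  have hD1 := (Matrix.mem_rowStochastic_iff_sum.1 hDs).2
  have hDD : D * D ∈ Matrix.rowStochastic ℝ E := mul_mem hDs hDs
  -- The orbit `ρ` is only known to evolve by `D * D`, whereas the step turns `ρ k₁` into `ρ k₁ ᵥ*
  -- D`. Identifying `ρ` with the stationary vector of `D` reconciles the two.
  obtain ⟨π, ⟨hπ, hπD⟩, -⟩ := existsUnique_isStationaryVector hD hD1
  have hρπ := eq_of_forall_vecMul (SPCA.mul_self_pos hD)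
    (Matrix.mem_rowStochastic_iff_sum.1 hDD).2 hρ (fun _ => hπ) (fun k => funext (hρD k))
    fun _ => by rw [← Matrix.vecMul_vecMul, hπD, hπD]
  refine ⟨hμp, ext_of_zigzagCylinder fun k₁ k₂ hk x y => ?_⟩
  rw [A.step_zigzagCylinder_of_chain hD1 hμc hk.le]
  refine Eq.trans ?_ (hμc k₁ k₂ hk x y).symm
  simp only [(A.isBridgeKernel_tilde_iff hpos hD).1 hDK, hρπ, hπD]

/-- The window `[0, 1]` suffices. Summing its identity over the other two letters gives `ρ 0 ᵥ* D =
ρ 0`; the common factor then cancels wherever `ρ 0` is positive, and positive rates spread this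
positivity to all of `E`. -/
theorem isBridgeKernel_of_isInvariant [Nonempty E] (A : TPCA E)
    (hpos : ∀ y x y' z, 0 < A.T y x y' z) {D : Matrix E E ℝ}
    {μ : Measure ((ℤ → E) × (ℤ → E))} (hμ : IsHZMC D D μ) (hA : A.IsInvariant μ) :
    (∀ x y, 0 < D x y) ∧ SPCA.IsBridgeKernel D A.tilde := by
  obtain ⟨hDs, -, hμp, ρ, hρ, hρD, hμc⟩ := hμ
  obtain ⟨hD0, hD1⟩ := Matrix.mem_rowStochastic_iff_sum.1 hDs
  have hDD1 : ∀ a, ∑ a', (D * D) a a' = 1 :=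
    (Matrix.mem_rowStochastic_iff_sum.1 (mul_mem hDs hDs)).2
  have hwin : ∀ a b a', (ρ 0 ᵥ* D) a * A.bridgeRate D a a' b = ρ 0 a * (D a b * D b a') := by
    intro a b a'
    let x (i : ℤ) : E := if i = 0 then a else a'
    have h1 := A.step_zigzagCylinder_of_chain hD1 hμc (k₁ := 0) (k₂ := 1) (by omega) x
      fun _ => b
    rw [hA.2] at h1
    have h2 := h1.symm.trans (hμc 0 1 (by omega) x fun _ => b)
    have hIco : Finset.Ico (0 : ℤ) 1 = {0} := by ext i; simp; omega
    rw [hIco, Finset.prod_singleton, Finset.prod_singleton] at h2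
    exact h2
  have hrate : ∀ a, ∑ a', ∑ b, A.bridgeRate D a a' b = 1 := by
    intro a
    rw [← hDD1 a]
    refine Finset.sum_congr rfl fun a' _ => ?_
    simp only [bridgeRate]
    rw [Finset.sum_comm]
    simp only [← Finset.mul_sum, A.sum_eq_one, mul_one]
    rfl
  have hρ0 : ρ 0 ᵥ* D = ρ 0 := by
    ext a
    have h : ∑ a', ∑ b, (ρ 0 ᵥ* D) a * A.bridgeRate D a a' b
        = ∑ a', ∑ b, ρ 0 a * (D a b * D b a') :=
      Finset.sum_congr rfl fun a' _ => Finset.sum_congr rfl fun b _ => hwin a b a'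
    simp only [← Finset.mul_sum, hrate, mul_one] at h
    rw [h]
    refine (congrArg _ (hDD1 a)).trans (mul_one _)
  have heq : ∀ a, 0 < ρ 0 a → ∀ a' b, A.bridgeRate D a a' b = D a b * D b a' := by
    intro a ha a' b
    have h := hwin a b a'
    rw [hρ0] at h
    exact mul_left_cancel₀ ha.ne' h
  -- A nonzero two-step path from `a` to some `a'` makes every bridge rate between them positive, so
  -- `D a b * D b a'` is positive for all `b`.
  have hrow : ∀ a, 0 < ρ 0 a → ∀ b, 0 < D a b := by
    intro a ha b
    obtain ⟨a', ha'⟩ : ∃ a', (D * D) a a' ≠ 0 := by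
      by_contra! h
      have := hDD1 a
      simp [h] at this
    obtain ⟨x, -, hx⟩ := Finset.exists_ne_zero_of_sum_ne_zero
      (show ∑ x, D a x * D x a' ≠ 0 from ha')
    have h1 : 0 < A.bridgeRate D a a' b :=
      Finset.sum_pos' (fun x _ => mul_nonneg (mul_nonneg (hD0 _ _) (hD0 _ _)) (A.nonneg _ _ _ _))
        ⟨x, Finset.mem_univ x, mul_pos (lt_of_le_of_ne (mul_nonneg (hD0 _ _) (hD0 _ _)) hx.symm)
          (hpos _ _ _ _)⟩
    rw [heq a ha] at h1
    exact pos_of_mul_pos_left h1 (hD0 _ _)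
  obtain ⟨a, ha⟩ : ∃ a, ρ 0 a ≠ 0 := by
    by_contra! h
    have := (hρ 0).2
    simp [h] at this
  have ha' : 0 < ρ 0 a := lt_of_le_of_ne ((hρ 0).1 a) ha.symm
  have hall : ∀ b, 0 < ρ 0 b := by
    intro b
    rw [← hρ0]
    exact Finset.sum_pos' (fun x _ => mul_nonneg ((hρ 0).1 x) (hD0 x b))
      ⟨a, Finset.mem_univ a, mul_pos ha' (hrow a ha' b)⟩
  have hD : ∀ x y, 0 < D x y := fun x => hrow x (hall x)
  exact ⟨hD, (A.isBridgeKernel_tilde_iff hpos hD).2 fun y y' z => heq y (hall y) y' z⟩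

end TPCA

theorem mainTheorem10 {E : Type*} [Fintype E] [DecidableEq E] [MeasurableSpace E]
    [DiscreteMeasurableSpace E] (o : E) (A : TPCA E)
    (hpos : ∀ y x y' z, 0 < A.T y x y' z) :
    -- the vectors that define the kernel `A.tilde`, `ν` and `γ` exist and are unique
    (∀ y y', ∃! v : E → ℝ, IsStationaryVector (A.sliceMatrix y y') v) ∧
    (∀ y y' z, 0 < A.tilde y y' z) ∧
    (∃! v : E → ℝ, IsStationaryVector (SPCA.diagMatrix A.tilde) v) ∧
    (∃! v : E → ℝ, IsPerronVector (SPCA.gammaMatrix o A.tilde) v) ∧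
    -- the characterization
    ((∃ (D : Matrix E E ℝ) (μ : Measure ((ℤ → E) × (ℤ → E))),
        IsHZMC D D μ ∧ A.IsInvariant μ) ↔
      SPCA.Cond1 o A.tilde ∧ SPCA.Cond2 o A.tilde ∧
        SPCA.Dmat o A.tilde (SPCA.gamma o A.tilde)
          = SPCA.Umat o A.tilde (SPCA.gamma o A.tilde)) ∧
    -- in this case, the `(D^γ, D^γ)`-HZMC distribution exists, is unique, and is invariant
    (SPCA.Cond1 o A.tilde ∧ SPCA.Cond2 o A.tilde ∧
        SPCA.Dmat o A.tilde (SPCA.gamma o A.tilde)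
          = SPCA.Umat o A.tilde (SPCA.gamma o A.tilde) →
      ∃ μ : Measure ((ℤ → E) × (ℤ → E)),
        IsHZMC (SPCA.Dmat o A.tilde (SPCA.gamma o A.tilde))
          (SPCA.Dmat o A.tilde (SPCA.gamma o A.tilde)) μ ∧
        A.IsInvariant μ ∧
        ∀ μ' : Measure ((ℤ → E) × (ℤ → E)),
          IsHZMC (SPCA.Dmat o A.tilde (SPCA.gamma o A.tilde))
            (SPCA.Dmat o A.tilde (SPCA.gamma o A.tilde)) μ' → μ' = μ) := by
  have : Nonempty E := ⟨o⟩
  have hK := A.tilde_pos hpos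
  have hK1 := A.sum_tilde hpos
  have hback : SPCA.Cond1 o A.tilde ∧ SPCA.Cond2 o A.tilde ∧
        SPCA.Dmat o A.tilde (SPCA.gamma o A.tilde)
          = SPCA.Umat o A.tilde (SPCA.gamma o A.tilde) →
      ∃ μ : Measure ((ℤ → E) × (ℤ → E)),
        IsHZMC (SPCA.Dmat o A.tilde (SPCA.gamma o A.tilde))
          (SPCA.Dmat o A.tilde (SPCA.gamma o A.tilde)) μ ∧
        A.IsInvariant μ ∧
        ∀ μ' : Measure ((ℤ → E) × (ℤ → E)),
          IsHZMC (SPCA.Dmat o A.tilde (SPCA.gamma o A.tilde))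
            (SPCA.Dmat o A.tilde (SPCA.gamma o A.tilde)) μ' → μ' = μ := by
    rintro ⟨h1, -, h3⟩
    have hγ := SPCA.gamma_pos (o := o) hK hK1
    have hDK := SPCA.isBridgeKernel_of_cond1 hK hK1 h1 hγ h3
    have hD : ∀ x y, 0 < SPCA.Dmat o A.tilde (SPCA.gamma o A.tilde) x y := by
      rw [h3]; exact SPCA.Umat_pos hK hγ
    have hD1 : ∀ x, ∑ y, SPCA.Dmat o A.tilde (SPCA.gamma o A.tilde) x y = 1 := by
      rw [h3]; exact SPCA.sum_Umat hK hγ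
    obtain ⟨μ, hμ⟩ := exists_isHZMC hD hD1
    exact ⟨μ, hμ, A.isInvariant_of_isBridgeKernel hpos hD hDK hμ, fun μ' hμ' => hμ'.unique hD hμ⟩
  refine ⟨A.existsUnique_tilde hpos, hK, SPCA.existsUnique_nu hK hK1,
    SPCA.existsUnique_gamma hK hK1, ⟨?_, fun h => ?_⟩, hback⟩
  · rintro ⟨D, μ, hμ, hA⟩
    obtain ⟨hD, hDK⟩ := A.isBridgeKernel_of_isInvariant hpos hμ hA
    have hD1 := (Matrix.mem_rowStochastic_iff_sum.1 hμ.1).2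
    -- Both `Dmat` and `Umat` become `D`, so (2) and (3) are trivial.
    simp only [SPCA.Cond2, hDK.gamma_eq hD hD1 hK hK1, hDK.Dmat_eq hD hD1, hDK.Umat_eq hD hD1,
      and_true]
    exact hDK.cond1 hD
  · obtain ⟨μ, hμ, hA, -⟩ := hback h
    exact ⟨_, μ, hμ, hA⟩
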